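/- Let $k$ be a field, let $N \cong \mathbb{Z}^2$ be a lattice of rank $2$, let $\Sigma$ be a complete fan of strongly convex rational polyhedral cones in $N_{\mathbb{R}} = N \otimes_{\mathbb{Z}} \mathbb{R}$, and let $X = X(\Sigma)$ be the corresponding complete toric surface over $k$. Let $\Sigma(1) \subset N$ be the set of primitive generators of the one-dimensional cones of $\Sigma$. The configuration $\Sigma(1)$ is called unimodular if every maximal linearly independent subset of $\Sigma(1)$ generates $N$, and $2$-regular if for every maximal linearly independent subset $B$ of $\Sigma(1)$ the quotient $N/\langle B\rangle$ is killed by multiplication by $2$. For an integer $q \geq 2$, multiplication by $q$ on $N$ preserves $\Sigma$ and induces an endomorphism $F$ of $X$ over $k$, given on each affine chart $\operatorname{Spec} k[\sigma^\vee \cap M]$, $M = \operatorname{Hom}(N,\mathbb{Z})$, by $x^m \mapsto x^{qm}$; write $F$ also for the endomorphism $F \times F$ of $X \times X = X \times_k X$. A splitting of $X \times X$ at $q$ is an $\mathcal{O}_{X \times X}$-module homomorphism $\pi \colon F_*\mathcal{O}_{X\times X} \to \mathcal{O}_{X\times X}$ whose composition with the canonical map $\mathcal{O}_{X\times X} \to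 F_*\mathcal{O}_{X\times X}$ is the identity, and $X$ is diagonally split at $q$ if there is such a $\pi$ that maps $F_* I_\Delta$ into $I_\Delta$, where $I_\Delta$ is the ideal sheaf of the diagonal. Then exactly one of the following holds: 1. $\Sigma(1)$ is unimodular, and $X$ is diagonally split at every integer $q \geq 2$. 2. $\Sigma(1)$ is $2$-regular but not unimodular, and for every integer $q \geq 2$, $X$ is diagonally split at $q$ if and only if $q$ is odd. 3. $\Sigma(1)$ is not $2$-regular, and $X$ is not diagonally split at any integer $q \geq 2$. -/

import Mathlib

open scoped TensorProduct
open CategoryTheory CategoryTheory.Limits AlgebraicGeometry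

universe u

noncomputable section

namespace Toric

/-! ### Cones and fans -/

/-- The real vector space `N_ℝ = ℝ ⊗ N` of a lattice `N`. -/
abbrev RealSpace (N : Type u) [AddCommGroup N] : Type u := ℝ ⊗[ℤ] N

/-- The pairing `⟨m, x⟩` of a point `m` of the dual lattice `M = Hom(N, ℤ)` with `x ∈ N_ℝ`. -/
def pairing {N : Type u} [AddCommGroup N] (m : Module.Dual ℤ N) : RealSpace N →ₗ[ℝ] ℝ :=
  Module.Dual.baseChange ℝ m

/-- The cone in `N_ℝ` spanned by a set of lattice points. -/
def latticeCone {N : Type u} [AddCommGroup N] (s : Set N) : PointedCone ℝ (RealSpace N) :=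
  PointedCone.hull ℝ ((fun v : N => (1 : ℝ) ⊗ₜ[ℤ] v) '' s)

/-- `τ` is a face of the rational polyhedral cone `σ`: there is `m ∈ σ^∨ ∩ M` with
`τ = σ ∩ m^⊥`. -/
def IsFace {N : Type u} [AddCommGroup N] (τ σ : PointedCone ℝ (RealSpace N)) : Prop :=
  ∃ m : Module.Dual ℤ N, (∀ x ∈ σ, 0 ≤ pairing m x) ∧
    ∀ x, x ∈ τ ↔ x ∈ σ ∧ pairing m x = 0

/-- A fan in `N_ℝ`: a finite nonempty collection of strongly convex rational polyhedral cones
that contains every face of each of its members and in which the intersection of any two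
members is a face of each of the two. A strongly convex cone has `{0}` as a face, so nonempty
means that `{0}` is a member. -/
structure Fan (N : Type u) [AddCommGroup N] where
  cones : Set (PointedCone ℝ (RealSpace N))
  finite_cones : cones.Finite
  bot_mem : ⊥ ∈ cones
  rational : ∀ σ ∈ cones, ∃ s : Set N, s.Finite ∧ σ = latticeCone s
  strongly_convex : ∀ σ ∈ cones, ∀ x ∈ σ, -x ∈ σ → x = 0
  face_mem : ∀ σ ∈ cones, ∀ τ, IsFace τ σ → τ ∈ cones
  inter_isFace_left : ∀ σ ∈ cones, ∀ τ ∈ cones, IsFace (σ ⊓ τ) σ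
  inter_isFace_right : ∀ σ ∈ cones, ∀ τ ∈ cones, IsFace (σ ⊓ τ) τ

/-- A fan is complete if its cones cover `N_ℝ`. -/
def Fan.IsComplete {N : Type u} [AddCommGroup N] (S : Fan N) : Prop :=
  ∀ x : RealSpace N, ∃ σ ∈ S.cones, x ∈ σ

/-- A lattice point is primitive if it is nonzero and not a proper multiple of a lattice point. -/
def IsPrimitive {N : Type u} [AddCommGroup N] (v : N) : Prop :=
  v ≠ 0 ∧ ∀ (d : ℕ) (w : N), v = d • w → d = 1

/-- `Σ(1)`: the primitive generators of the one-dimensional cones of the fan. -/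
def Fan.rays {N : Type u} [AddCommGroup N] (S : Fan N) : Set N :=
  {v | IsPrimitive v ∧ latticeCone {v} ∈ S.cones}

/-! ### Vector configurations -/

/-- The maximal (linearly) independent subsets of a configuration `V` of lattice vectors. -/
def IsMaxIndep {N : Type u} [AddCommGroup N] (V : Set N) (B : Set N) : Prop :=
  Maximal (fun C : Set N => C ⊆ V ∧ LinearIndepOn ℤ id C) B

/-- Every maximal independent subset generates the lattice. -/
def IsUnimodular {N : Type u} [AddCommGroup N] (V : Set N) : Prop :=
  ∀ B : Set N, IsMaxIndep V B → Submodule.span ℤ B = ⊤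

/-- For every maximal independent subset `B`, the quotient `N / ⟨B⟩` is `r`-torsion, that is,
killed by multiplication by `r`. -/
def IsRegular (r : ℕ) {N : Type u} [AddCommGroup N] (V : Set N) : Prop :=
  ∀ B : Set N, IsMaxIndep V B → ∀ x : N ⧸ Submodule.span ℤ B, r • x = 0

/-! ### Affine charts -/

/-- The semigroup `σ^∨ ∩ M`. -/
def dualMonoid {N : Type u} [AddCommGroup N] (σ : PointedCone ℝ (RealSpace N)) :
    AddSubmonoid (Module.Dual ℤ N) where
  carrier := {m | ∀ x ∈ σ, 0 ≤ pairing m x}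
  zero_mem' := by
    intro x _
    simp [pairing]
  add_mem' := by
    intro a b ha hb x hx
    have h1 := ha x hx
    have h2 := hb x hx
    simp only [pairing, map_add, LinearMap.add_apply] at h1 h2 ⊢
    exact add_nonneg h1 h2

lemma dualMonoid_anti {N : Type u} [AddCommGroup N] {τ σ : PointedCone ℝ (RealSpace N)}
    (h : τ ≤ σ) : dualMonoid σ ≤ dualMonoid τ :=
  fun _ hm x hx => hm x (h hx)

/-- The coordinate ring `k[σ^∨ ∩ M]` of the affine chart `U_σ`. -/
abbrev ChartRing (k : Type u) [Field k] {N : Type u} [AddCommGroup N]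
    (σ : PointedCone ℝ (RealSpace N)) : Type u :=
  AddMonoidAlgebra k (dualMonoid σ)

/-- For `τ ⊆ σ`, the inclusion `k[σ^∨ ∩ M] ⊆ k[τ^∨ ∩ M]`. -/
def chartMap (k : Type u) [Field k] {N : Type u} [AddCommGroup N]
    {τ σ : PointedCone ℝ (RealSpace N)} (h : τ ≤ σ) : ChartRing k σ →ₐ[k] ChartRing k τ :=
  AddMonoidAlgebra.mapDomainAlgHom k k (AddSubmonoid.inclusion (dualMonoid_anti h))

/-- The endomorphism `x^m ↦ x^{qm}` of `k[σ^∨ ∩ M]`. -/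
def chartFrobenius (k : Type u) [Field k] {N : Type u} [AddCommGroup N]
    (σ : PointedCone ℝ (RealSpace N)) (q : ℕ) : ChartRing k σ →ₐ[k] ChartRing k σ :=
  AddMonoidAlgebra.mapDomainAlgHom k k (nsmulAddMonoidHom q)

/-! The chart of a face is the basic open subset on which a monomial is invertible. -/

lemma chartMap_single (k : Type u) [Field k] {N : Type u} [AddCommGroup N]
    {τ σ : PointedCone ℝ (RealSpace N)} (h : τ ≤ σ) (m : dualMonoid σ) (c : k) :
    chartMap k h (AddMonoidAlgebra.single m c) =
      AddMonoidAlgebra.single (AddSubmonoid.inclusion (dualMonoid_anti h) m) c := by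
  simp [chartMap]

lemma chartFrobenius_single (k : Type u) [Field k] {N : Type u} [AddCommGroup N]
    (σ : PointedCone ℝ (RealSpace N)) (q : ℕ) (m : dualMonoid σ) (c : k) :
    chartFrobenius k σ q (AddMonoidAlgebra.single m c) = AddMonoidAlgebra.single (q • m) c := by
  simp [chartFrobenius]

lemma chartMap_injective (k : Type u) [Field k] {N : Type u} [AddCommGroup N]
    {τ σ : PointedCone ℝ (RealSpace N)} (h : τ ≤ σ) : Function.Injective (chartMap k h) :=
  AddMonoidAlgebra.mapDomain_injective (AddSubmonoid.inclusion_injective _)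

lemma chartMap_refl (k : Type u) [Field k] {N : Type u} [AddCommGroup N]
    (σ : PointedCone ℝ (RealSpace N)) : chartMap k (le_refl σ) = AlgHom.id k _ :=
  AddMonoidAlgebra.mapDomainAlgHom_id

lemma chartMap_comp (k : Type u) [Field k] {N : Type u} [AddCommGroup N]
    {ρ τ σ : PointedCone ℝ (RealSpace N)} (h : ρ ≤ τ) (h' : τ ≤ σ) :
    (chartMap k h).comp (chartMap k h') = chartMap k (h.trans h') :=
  (AddMonoidAlgebra.mapDomainAlgHom_comp (R := k) (A := k) _ _).symm

lemma chartMap_chartFrobenius (k : Type u) [Field k] {N : Type u} [AddCommGroup N]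
    {τ σ : PointedCone ℝ (RealSpace N)} (h : τ ≤ σ) (q : ℕ) :
    (chartMap k h).comp (chartFrobenius k σ q) = (chartFrobenius k τ q).comp (chartMap k h) := by
  ext m
  simp [chartMap, chartFrobenius]

lemma exists_add_nsmul_mem {N : Type u} [AddCommGroup N] {s : Set N} (hs : s.Finite)
    {τ : PointedCone ℝ (RealSpace N)} (m : Module.Dual ℤ N)
    (hm : ∀ x ∈ latticeCone s, 0 ≤ pairing m x)
    (hτ : ∀ x, x ∈ τ ↔ x ∈ latticeCone s ∧ pairing m x = 0)
    (w : Module.Dual ℤ N) (hw : w ∈ dualMonoid τ) :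
    ∃ n : ℕ, w + n • m ∈ dualMonoid (latticeCone s) := by
  have mem : ∀ v ∈ s, (1 : ℝ) ⊗ₜ[ℤ] v ∈ latticeCone s := fun v hv =>
    Submodule.subset_span ⟨v, hv, rfl⟩
  have ev : ∀ (a : Module.Dual ℤ N) (v : N), pairing a ((1 : ℝ) ⊗ₜ[ℤ] v) = (a v : ℝ) := by
    intro a v
    simp [pairing]
  have hpos : ∀ v ∈ s, 0 ≤ m v := by
    intro v hv
    have := hm _ (mem v hv)
    rw [ev] at this
    exact_mod_cast this
  have hzero : ∀ v ∈ s, m v = 0 → 0 ≤ w v := by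
    intro v hv h0
    have := hw _ ((hτ _).2 ⟨mem v hv, by rw [ev, h0]; simp⟩)
    rw [ev] at this
    exact_mod_cast this
  obtain ⟨n, hn⟩ : ∃ n : ℕ, ∀ v ∈ s, -w v ≤ n := by
    obtain ⟨b, hb⟩ := (hs.image fun v => -w v).bddAbove
    refine ⟨b.toNat, fun v hv => (hb ⟨v, hv, rfl⟩).trans (Int.self_le_toNat b)⟩
  refine ⟨n, fun x hx => ?_⟩
  refine Submodule.span_induction (p := fun x _ => 0 ≤ pairing (w + n • m) x) ?_ ?_ ?_ ?_ hx
  · rintro _ ⟨v, hv, rfl⟩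
    simp only [ev]
    have key : 0 ≤ (w + n • m) v := by
      simp only [LinearMap.add_apply, LinearMap.smul_apply, nsmul_eq_mul]
      rcases (hpos v hv).eq_or_lt with h | h
      · have := hzero v hv h.symm
        rw [← h]
        simpa using this
      · have h1 := hn v hv
        have h2 : (n : ℤ) * 1 ≤ n * m v := mul_le_mul_of_nonneg_left h (by positivity)
        linarith
    exact_mod_cast key
  · simp
  · intro a b _ _ ha hb
    rw [map_add]
    exact add_nonneg ha hb
  · intro c a _ ha
    have : c • a = (c : ℝ) • a := rfl
    rw [this, map_smul]
    exact mul_nonneg c.2 ha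

lemma isLocalization_chart (k : Type u) [Field k] {N : Type u} [AddCommGroup N]
    {τ σ : PointedCone ℝ (RealSpace N)} (hσ : ∃ s : Set N, s.Finite ∧ σ = latticeCone s)
    (h : τ ≤ σ) (m : Module.Dual ℤ N) (hm : m ∈ dualMonoid σ)
    (hτ : ∀ x, x ∈ τ ↔ x ∈ σ ∧ pairing m x = 0) :
    letI := (chartMap k h).toRingHom.toAlgebra
    IsLocalization.Away (AddMonoidAlgebra.single (⟨m, hm⟩ : dualMonoid σ) (1 : k))
      (ChartRing k τ) := by
  let _ := (chartMap k h).toRingHom.toAlgebra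
  have alg : ∀ a, algebraMap (ChartRing k σ) (ChartRing k τ) a = chartMap k h a := fun _ => rfl
  have hneg : -m ∈ dualMonoid τ := by
    intro x hx
    have := ((hτ x).1 hx).2
    simp only [pairing, map_neg, LinearMap.neg_apply] at this ⊢
    rw [this, neg_zero]
  obtain ⟨s, hs, rfl⟩ := hσ
  refine ⟨?_, ?_, ?_⟩
  · rintro ⟨_, n, rfl⟩
    rw [map_pow]
    refine IsUnit.pow n ?_
    rw [alg, chartMap_single]
    refine IsUnit.of_mul_eq_one (AddMonoidAlgebra.single (⟨-m, hneg⟩ : dualMonoid τ) (1 : k)) ?_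
    rw [AddMonoidAlgebra.single_mul_single, AddMonoidAlgebra.one_def, one_mul]
    congr 1
    ext1
    simp
  · intro b
    suffices H : ∃ (n : ℕ) (a : ChartRing k (latticeCone s)),
        b * chartMap k h (AddMonoidAlgebra.single (⟨m, hm⟩ : dualMonoid _) (1 : k)) ^ n =
          chartMap k h a by
      obtain ⟨n, a, ha⟩ := H
      exact ⟨⟨a, ⟨_, n, rfl⟩⟩, by rw [alg, alg, ← ha, map_pow]⟩
    induction b using AddMonoidAlgebra.induction_linear with
    | zero => exact ⟨0, 0, by simp⟩
    | add f g hf hg =>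
      obtain ⟨n, a, ha⟩ := hf
      obtain ⟨n', a', ha'⟩ := hg
      refine ⟨n + n', a * AddMonoidAlgebra.single (⟨m, hm⟩ : dualMonoid _) (1 : k) ^ n' +
        a' * AddMonoidAlgebra.single (⟨m, hm⟩ : dualMonoid _) (1 : k) ^ n, ?_⟩
      simp only [map_add, map_mul, map_pow, ← ha, ← ha']
      ring
    | single w c =>
      obtain ⟨n, hn⟩ := exists_add_nsmul_mem hs m hm hτ w.1 w.2
      refine ⟨n, AddMonoidAlgebra.single (⟨_, hn⟩ : dualMonoid _) c, ?_⟩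
      rw [chartMap_single, chartMap_single, AddMonoidAlgebra.single_pow,
        AddMonoidAlgebra.single_mul_single, one_pow, mul_one]
      congr 1
  · intro a b hab
    exact ⟨1, by rw [chartMap_injective k h hab]⟩

/-! ### The toric variety of a fan -/

/-- The diagram of affine charts `U_σ = Spec k[σ^∨ ∩ M]`, for `σ` in the fan, with the maps
`U_τ ⟶ U_σ` for `τ ⊆ σ`. -/
def chartFunctor (k : Type u) [Field k] {N : Type u} [AddCommGroup N] (S : Fan N) :
    S.cones ⥤ Scheme.{u} where
  obj σ := Spec (.of (ChartRing k σ.1))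
  map {_ _} f := Spec.map (CommRingCat.ofHom (chartMap k (leOfHom f)).toRingHom)
  map_id σ := by
    have : CommRingCat.ofHom (chartMap k (le_refl σ.1)).toRingHom = 𝟙 _ := by
      rw [chartMap_refl]
      rfl
    exact (congrArg Spec.map this).trans (Spec.map_id _)
  map_comp {_ _ _} f g := by
    rw [← Spec.map_comp, ← CommRingCat.ofHom_comp]
    congr 2
    exact (congrArg AlgHom.toRingHom (chartMap_comp k (leOfHom f) (leOfHom g))).symm

lemma exists_isLocalization (k : Type u) [Field k] {N : Type u} [AddCommGroup N] (S : Fan N)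
    {τ σ : S.cones} (h : τ.1 ≤ σ.1) :
    ∃ m : dualMonoid σ.1, (∀ x, x ∈ τ.1 ↔ x ∈ σ.1 ∧ pairing m.1 x = 0) ∧
      letI := (chartMap k h).toRingHom.toAlgebra
      IsLocalization.Away (AddMonoidAlgebra.single m (1 : k)) (ChartRing k τ.1) := by
  obtain ⟨m, hm, hτ⟩ := S.inter_isFace_left σ.1 σ.2 τ.1 τ.2
  rw [inf_eq_right.2 h] at hτ
  exact ⟨⟨m, hm⟩, hτ, isLocalization_chart k (S.rational σ.1 σ.2) h m hm hτ⟩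

instance isOpenImmersion_chart (k : Type u) [Field k] {N : Type u} [AddCommGroup N] (S : Fan N)
    {τ σ : S.cones} (f : τ ⟶ σ) : IsOpenImmersion ((chartFunctor k S).map f) := by
  obtain ⟨m, -, hm⟩ := exists_isLocalization k S (leOfHom f)
  let _ := (chartMap k (leOfHom f)).toRingHom.toAlgebra
  exact IsOpenImmersion.of_isLocalization (AddMonoidAlgebra.single m (1 : k))

lemma range_chart (k : Type u) [Field k] {N : Type u} [AddCommGroup N] (S : Fan N)
    {τ σ : S.cones} (f : τ ⟶ σ) (m : dualMonoid σ.1)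
    (hτ : ∀ x, x ∈ τ.1 ↔ x ∈ σ.1 ∧ pairing m.1 x = 0) :
    Set.range ((chartFunctor k S).map f) =
      (PrimeSpectrum.basicOpen (AddMonoidAlgebra.single m (1 : k)) :
        Set (PrimeSpectrum (ChartRing k σ.1))) := by
  have := isLocalization_chart k (S.rational σ.1 σ.2) (leOfHom f) m.1 m.2 hτ
  let _ := (chartMap k (leOfHom f)).toRingHom.toAlgebra
  exact PrimeSpectrum.localization_away_comap_range (ChartRing k τ.1)
    (AddMonoidAlgebra.single m (1 : k))

instance isLocallyDirected_chart (k : Type u) [Field k] {N : Type u} [AddCommGroup N]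
    (S : Fan N) : (chartFunctor k S ⋙ Scheme.forget).IsLocallyDirected := by
  constructor
  intro i j l fi fj x y hxy
  obtain ⟨a, ha, -⟩ := exists_isLocalization k S (leOfHom fi)
  obtain ⟨b, hb, -⟩ := exists_isLocalization k S (leOfHom fj)
  let t : S.cones := ⟨i.1 ⊓ j.1, S.face_mem _ i.2 _ (S.inter_isFace_left _ i.2 _ j.2)⟩
  let ti : t ⟶ i := homOfLE (show i.1 ⊓ j.1 ≤ i.1 from inf_le_left)
  let tj : t ⟶ j := homOfLE (show i.1 ⊓ j.1 ≤ j.1 from inf_le_right)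
  have hab : ∀ x, x ∈ t.1 ↔ x ∈ l.1 ∧ pairing (a + b).1 x = 0 := by
    intro x
    change x ∈ i.1 ⊓ j.1 ↔ _
    rw [Submodule.mem_inf, ha, hb]
    have hadd : pairing (a + b).1 x = pairing a.1 x + pairing b.1 x := by simp [pairing]
    constructor
    · rintro ⟨⟨h1, h2⟩, -, h3⟩
      exact ⟨h1, by rw [hadd, h2, h3, add_zero]⟩
    · rintro ⟨h1, h2⟩
      rw [hadd] at h2
      have h3 := a.2 x h1
      have h4 := b.2 x h1
      exact ⟨⟨h1, by linarith⟩, h1, by linarith⟩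
  have hx : (chartFunctor k S).map fi x ∈ Set.range ((chartFunctor k S).map fi) := ⟨x, rfl⟩
  have hy : (chartFunctor k S).map fi x ∈ Set.range ((chartFunctor k S).map fj) := ⟨y, hxy.symm⟩
  have hz : (chartFunctor k S).map fi x ∈ Set.range ((chartFunctor k S).map (ti ≫ fi)) := by
    rw [range_chart k S _ _ ha] at hx
    rw [range_chart k S _ _ hb] at hy
    rw [range_chart k S _ _ hab]
    have : AddMonoidAlgebra.single (a + b) (1 : k) =
        AddMonoidAlgebra.single a 1 * AddMonoidAlgebra.single b 1 := by
      rw [AddMonoidAlgebra.single_mul_single, one_mul]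
    rw [this, PrimeSpectrum.basicOpen_mul]
    exact ⟨hx, hy⟩
  obtain ⟨z, hz⟩ := hz
  refine ⟨t, ti, tj, z, ?_, ?_⟩
  · apply ((chartFunctor k S).map fi).isOpenEmbedding.injective
    rw [← hz, Functor.map_comp]
    rfl
  · apply ((chartFunctor k S).map fj).isOpenEmbedding.injective
    refine Eq.trans ?_ (hz.trans hxy)
    rw [Subsingleton.elim (ti ≫ fi) (tj ≫ fj), Functor.map_comp]
    rfl

/-- The toric variety `X(Σ)` over `k`: the affine charts `U_σ` and `U_τ` are glued along their
common open subscheme `U_{σ ∩ τ}`. -/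
def toricVariety (k : Type u) [Field k] {N : Type u} [AddCommGroup N] (S : Fan N) : Scheme.{u} :=
  colimit (chartFunctor k S)

/-- The structure morphism `X(Σ) ⟶ Spec k`. -/
def structureMap (k : Type u) [Field k] {N : Type u} [AddCommGroup N] (S : Fan N) :
    toricVariety k S ⟶ Spec (.of k) :=
  colimit.desc (chartFunctor k S)
    { pt := Spec (.of k)
      ι :=
        { app := fun σ => Spec.map (CommRingCat.ofHom (algebraMap k (ChartRing k σ.1)))
          naturality := by
            intro τ σ f
            refine Eq.trans ?_ (Category.comp_id _).symm
            refine (Spec.map_comp _ _).symm.trans (congrArg Spec.map ?_)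
            exact CommRingCat.hom_ext (RingHom.ext (chartMap k (leOfHom f)).commutes) } }

/-- The endomorphism `F` of `X(Σ)` induced by multiplication by `q` on `N`. On each chart it is
given by `x^m ↦ x^{qm}`. -/
def frobenius (k : Type u) [Field k] {N : Type u} [AddCommGroup N] (S : Fan N) (q : ℕ) :
    toricVariety k S ⟶ toricVariety k S :=
  colimMap
    { app := fun σ => Spec.map (CommRingCat.ofHom (chartFrobenius k σ.1 q).toRingHom)
      naturality := by
        intro τ σ f
        refine (Spec.map_comp _ _).symm.trans (Eq.trans (congrArg Spec.map ?_) (Spec.map_comp _ _))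
        exact CommRingCat.hom_ext
          (congrArg AlgHom.toRingHom (chartMap_chartFrobenius k (leOfHom f) q)) }

lemma frobenius_structureMap (k : Type u) [Field k] {N : Type u} [AddCommGroup N] (S : Fan N)
    (q : ℕ) : frobenius k S q ≫ structureMap k S = structureMap k S := by
  refine colimit.hom_ext fun σ => ?_
  simp only [frobenius, structureMap]
  erw [ι_colimMap_assoc, colimit.ι_desc]
  refine (Spec.map_comp _ _).symm.trans (congrArg Spec.map ?_)
  exact CommRingCat.hom_ext (RingHom.ext (chartFrobenius k σ.1 q).commutes)

/-- The product `X × X` over `k`. -/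
abbrev square (k : Type u) [Field k] {N : Type u} [AddCommGroup N] (S : Fan N) : Scheme.{u} :=
  pullback (structureMap k S) (structureMap k S)

/-- The diagonal `X ⟶ X × X`. -/
abbrev diagonal (k : Type u) [Field k] {N : Type u} [AddCommGroup N] (S : Fan N) :
    toricVariety k S ⟶ square k S :=
  pullback.diagonal (structureMap k S)

/-- The endomorphism `F` of the toric variety `X × X` induced by multiplication by `q` on
`N × N`, that is, the product of the endomorphisms `F` of the two factors. -/
def squareFrobenius (k : Type u) [Field k] {N : Type u} [AddCommGroup N] (S : Fan N) (q : ℕ) :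
    square k S ⟶ square k S :=
  pullback.map _ _ _ _ (frobenius k S q) (frobenius k S q) (𝟙 _)
    (by rw [frobenius_structureMap, Category.comp_id])
    (by rw [frobenius_structureMap, Category.comp_id])

/-! ### Splittings -/

/-- A splitting of an endomorphism `F : Y ⟶ Y` of a scheme: an `𝒪_Y`-module homomorphism
`π : F_* 𝒪_Y ⟶ 𝒪_Y` whose composition with the canonical map `𝒪_Y ⟶ F_* 𝒪_Y` is the identity.
The sections of `F_* 𝒪_Y` over `U` are `𝒪_Y(F⁻¹ U)`, on which `𝒪_Y(U)` acts through the pullback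
of functions. -/
structure Splitting {Y : Scheme.{u}} (F : Y ⟶ Y) where
  app (U : Y.Opens) : Γ(Y, F ⁻¹ᵁ U) →+ Γ(Y, U)
  map_smul (U : Y.Opens) (a : Γ(Y, U)) (b : Γ(Y, F ⁻¹ᵁ U)) :
    app U (F.app U a * b) = a * app U b
  naturality {U V : Y.Opens} (i : U ≤ V) (b : Γ(Y, F ⁻¹ᵁ V)) :
    app U (Y.presheaf.map (homOfLE (F.preimage_mono i)).op b) =
      Y.presheaf.map (homOfLE i).op (app V b)
  split (U : Y.Opens) (a : Γ(Y, U)) : app U (F.app U a) = a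

/-- The sections over `U` of the ideal sheaf of a closed subscheme `j : Z ⟶ Y`: the functions
on `U` that restrict to zero on `Z`. -/
def idealSections {Z Y : Scheme.{u}} (j : Z ⟶ Y) (U : Y.Opens) : Ideal Γ(Y, U) :=
  RingHom.ker (j.app U).hom

/-- The splitting `π` is compatible with the closed subscheme `j : Z ⟶ Y`: it maps `F_* I_Z`
into `I_Z`. -/
def Splitting.IsCompatible {Z Y : Scheme.{u}} {F : Y ⟶ Y} (π : Splitting F) (j : Z ⟶ Y) : Prop :=
  ∀ (U : Y.Opens), ∀ b ∈ idealSections j (F ⁻¹ᵁ U), π.app U b ∈ idealSections j U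

/-- `X(Σ)` is diagonally split at `q`: there is a splitting of `X × X` at `q` that is compatible
with the diagonal. -/
def IsDiagonallySplit (k : Type u) [Field k] {N : Type u} [AddCommGroup N] (S : Fan N)
    (q : ℕ) : Prop :=
  ∃ π : Splitting (squareFrobenius k S q), π.IsCompatible (diagonal k S)

/-- Exactly one of three propositions holds. -/
def ExactlyOne (P Q R : Prop) : Prop :=
  (P ∨ Q ∨ R) ∧ ¬ (P ∧ Q) ∧ ¬ (P ∧ R) ∧ ¬ (Q ∧ R)

end Toric

end

/-! The bridge between geometry and lattices is `isDiagonallySplit_iff`: `X` is diagonally split at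
`q` exactly when every class of `M / qM` has a representative `m` with `|m v| < q` for every `v` in
`Σ(1)` (`HasSmallResidues`).

Suppose first that `X × X` has a diagonal splitting. Apply it to `x^{(m, -m)}`, which is congruent
to `1` modulo the ideal of the diagonal of the torus. The image restricts to `1` on the diagonal, so
it contains some monomial `x^{(e, -e)}`. Since the splitting is semilinear and preserves the
functions regular on the charts `U_v × T` and `T × U_v` of each ray, both `m v - q e v < q` and `q e
v - m v < q` follow (`hasSmallResidues_of_splitting`). Conversely, choose small representatives `m -
q d(m)`, constant on classes modulo `q`. Sending `x^{(m, n)}` with `m + n = q s` to `x^{(d(m), s -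
d(m))}`, and all other monomials to zero, gives a splitting of the torus. The bound `|m v - q d(m)
v| < q` makes it preserve the regular functions on every chart. After restriction to the diagonal
the image depends only on `m + n`, whence compatibility. The map extends to the function field and
then glues over all open subsets (`GenericCharts.splitting`,
`GenericCharts.splitting_isCompatible`).

What remains is plane geometry. The rays of a complete fan span the plane, so unimodularity and
2-regularity say that all determinants of pairs of rays are at most `1`, respectively `2`, in
absolute value. With bound `1` small residues exist for all `q`. If `2` is attained and is the
bound, half sums and half differences of two rays give a basis in which symmetric remainders work
for odd `q`. An even `q` with determinant `±2`, or any `q ≥ 2` with a determinant of size at least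
`3`, is obstructed by the class of `⌊q/2⌋ det(v, ·)` (`not_hasSmallResidues`). -/

namespace Toric

/-! ### Plane lattices -/

section Plane

variable {N : Type u} [AddCommGroup N]

/-- The determinant of two vectors of a plane lattice with respect to a basis. -/
noncomputable def area (b : Module.Basis (Fin 2) ℤ N) : N →ₗ[ℤ] Module.Dual ℤ N :=
  LinearMap.mk₂ ℤ (fun v w => b.coord 0 v * b.coord 1 w - b.coord 1 v * b.coord 0 w)
    (by intros; simp only [map_add]; ring) (by intros; simp only [map_smul, smul_eq_mul]; ring)
    (by intros; simp only [map_add]; ring) (by intros; simp only [map_smul, smul_eq_mul]; ring)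

variable (b : Module.Basis (Fin 2) ℤ N)

lemma area_apply (v w : N) :
    area b v w = b.coord 0 v * b.coord 1 w - b.coord 1 v * b.coord 0 w := rfl

lemma coord_injective {v w : N} (h₀ : b.coord 0 v = b.coord 0 w)
    (h₁ : b.coord 1 v = b.coord 1 w) : v = w := by
  refine b.ext_elem fun i => ?_
  fin_cases i
  · exact h₀
  · exact h₁

lemma area_self (v : N) : area b v v = 0 := by
  rw [area_apply]; ring

lemma area_swap (v w : N) : area b w v = -area b v w := by
  rw [area_apply, area_apply]; ring

/-- Cramer's rule without division. It serves as the source of coordinates with respect to any two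
independent lattice vectors. -/
lemma area_smul_eq (u v w : N) : area b v w • u = area b u w • v + area b v u • w := by
  apply coord_injective b <;>
  · simp only [map_add, map_smul, smul_eq_mul, area_apply]
    ring

lemma area_mul_apply (m : Module.Dual ℤ N) (u v w : N) :
    area b v w * m u = area b u w * m v + area b v u * m w := by
  simpa using congrArg m (area_smul_eq b u v w)

lemma eq_zero_of_smul_eq_zero (b : Module.Basis (Fin 2) ℤ N) {d : ℤ} (hd : d ≠ 0) {v : N}
    (h : d • v = 0) : v = 0 := by
  apply coord_injective b
  · have := congrArg (b.coord 0) h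
    simpa [hd] using this
  · have := congrArg (b.coord 1) h
    simpa [hd] using this

lemma exists_coord (x y : ℤ) : ∃ v : N, b.coord 0 v = x ∧ b.coord 1 v = y :=
  ⟨x • b 0 + y • b 1, by simp, by simp⟩

/-- The coordinates of a primitive vector are coprime, and Bézout coefficients, rotated by a quarter
turn, are the coordinates of `w`. -/
lemma IsPrimitive.exists_area_eq_one {v : N} (hv : IsPrimitive v) : ∃ w, area b v w = 1 := by
  set x := b.coord 0 v with hx
  set y := b.coord 1 v with hy
  obtain ⟨x', hx'⟩ := Int.gcd_dvd_left x y
  obtain ⟨y', hy'⟩ := Int.gcd_dvd_right x y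
  obtain ⟨v', h0, h1⟩ := exists_coord b x' y'
  have hg : Int.gcd x y = 1 := by
    apply hv.2 _ v'
    apply coord_injective b
    · rw [map_nsmul, h0, nsmul_eq_mul, ← hx', hx]
    · rw [map_nsmul, h1, nsmul_eq_mul, ← hy', hy]
  have hbez := Int.gcd_eq_gcd_ab x y
  obtain ⟨w, h0, h1⟩ := exists_coord b (-Int.gcdB x y) (Int.gcdA x y)
  refine ⟨w, ?_⟩
  rw [area_apply, h0, h1, ← hx, ← hy]
  rw [hg] at hbez
  push_cast at hbez
  linarith

lemma exists_isPrimitive (b : Module.Basis (Fin 2) ℤ N) {v : N} (hv : v ≠ 0) :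
    ∃ (d : ℕ) (w : N), 0 < d ∧ IsPrimitive w ∧ v = d • w := by
  set x := b.coord 0 v with hx
  set y := b.coord 1 v with hy
  have hpos : 0 < Int.gcd x y := by
    rw [Int.gcd_pos_iff]
    by_contra! h
    exact hv (coord_injective b (by simpa [hx] using h.1) (by simpa [hy] using h.2))
  obtain ⟨x', hx'⟩ := Int.gcd_dvd_left x y
  obtain ⟨y', hy'⟩ := Int.gcd_dvd_right x y
  obtain ⟨w, h0, h1⟩ := exists_coord b x' y'
  have hvw : v = Int.gcd x y • w := by
    apply coord_injective b
    · rw [map_nsmul, h0, nsmul_eq_mul, ← hx', hx]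
    · rw [map_nsmul, h1, nsmul_eq_mul, ← hy', hy]
  refine ⟨Int.gcd x y, w, hpos, ⟨?_, ?_⟩, hvw⟩
  · rintro rfl
    exact hv (by rw [hvw, smul_zero])
  · rintro d u rfl
    have hx2 : (d : ℤ) * Int.gcd x y ∣ x := ⟨b.coord 0 u, by
      rw [hx]; conv_lhs => rw [hvw]
      simp only [map_nsmul, nsmul_eq_mul]; ring⟩
    have hy2 : (d : ℤ) * Int.gcd x y ∣ y := ⟨b.coord 1 u, by
      rw [hy]; conv_lhs => rw [hvw]
      simp only [map_nsmul, nsmul_eq_mul]; ring⟩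
    have h := Int.dvd_coe_gcd hx2 hy2
    have h' : d * Int.gcd x y ∣ 1 * Int.gcd x y := by
      rw [one_mul]; exact_mod_cast h
    exact Nat.dvd_one.1 (Nat.dvd_of_mul_dvd_mul_right hpos h')

/-- Determinant `±1` makes `f, g` a lattice basis, so a functional can take prescribed values on it.
The squared form of the hypothesis covers both signs. -/
lemma exists_dual_eq {f g : N} (h : area b f g * area b f g = 1) (s t : ℤ) :
    ∃ e : Module.Dual ℤ N, e f = s ∧ e g = t := by
  refine ⟨area b f g • (t • area b f - s • area b g), ?_, ?_⟩
  · simp only [LinearMap.smul_apply, LinearMap.sub_apply, area_self, area_swap b f g, smul_eq_mul]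
    linear_combination s * h
  · simp only [LinearMap.smul_apply, LinearMap.sub_apply, area_self, smul_eq_mul]
    linear_combination t * h

lemma exists_eq_smul_of_area_eq_zero {v u : N} (hv : IsPrimitive v) (h : area b v u = 0) :
    ∃ c : ℤ, u = c • v := by
  obtain ⟨w, hw⟩ := hv.exists_area_eq_one b
  refine ⟨area b u w, ?_⟩
  have := area_smul_eq b u v w
  rwa [hw, h, one_smul, zero_smul, add_zero] at this

/-! ### Residues of the dual lattice -/

/-- Every residue class of `M` modulo `q` has a representative whose values on `V` are smaller than
`q` in absolute value. -/
def HasSmallResidues (V : Set N) (q : ℕ) : Prop :=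
  ∀ m : Module.Dual ℤ N, ∃ e : Module.Dual ℤ N, ∀ v ∈ V, |m v - q * e v| < q

/-- The class of `⌊q/2⌋ det(v, ·)` is the obstruction. A small representative must vanish on `v`,
hence is an integral multiple of `det(v, ·)`. Its value on `w` is then `det(v, w)` times an integer
congruent to `⌊q/2⌋` modulo `q`, which is too large. -/
lemma not_hasSmallResidues {V : Set N} {q : ℕ} {v w : N} (hv : v ∈ V) (hw : w ∈ V)
    (hvp : IsPrimitive v) (hq : 2 ≤ q) (h : (q : ℤ) ≤ |area b v w| * ((q / 2 : ℕ) : ℤ)) :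
    ¬ HasSmallResidues V q := by
  intro H
  obtain ⟨e, he⟩ := H (((q / 2 : ℕ) : ℤ) • area b v)
  obtain ⟨x, hx⟩ := hvp.exists_area_eq_one b
  have hq0 : (0 : ℤ) < q := by omega
  have h1 : e v = 0 := by
    have := he v hv
    rw [LinearMap.smul_apply, area_self, smul_zero, zero_sub, abs_neg, abs_mul,
      abs_of_pos hq0] at this
    have h2 : |e v| < 1 := by
      by_contra! h2
      nlinarith
    exact Int.abs_lt_one_iff.1 h2
  have h2 : e w = area b v w * e x := by
    have := area_mul_apply b e w v x
    rwa [hx, h1, one_mul, mul_zero, zero_add] at this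
  have h3 := he w hw
  rw [LinearMap.smul_apply, h2, smul_eq_mul] at h3
  set t : ℤ := ((q / 2 : ℕ) : ℤ) with ht
  have h4 : t * area b v w - q * (area b v w * e x) = area b v w * (t - q * e x) := by ring
  rw [h4, abs_mul] at h3
  have ht2 : 2 * t ≤ q := by omega
  -- Because `0 ≤ 2t ≤ q`, no multiple of `q` is closer to `t` than `0`.
  have h5 : t ≤ |t - q * e x| := by
    rcases le_or_gt (e x) 0 with h6 | h6
    · exact le_trans (by nlinarith) (le_abs_self _)
    · exact le_trans (by nlinarith) (neg_le_abs _)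
  nlinarith [abs_nonneg (area b v w)]

/-- When `α` and `β` do not have the same nonzero sign, the two nonnegative remainders are
subtracted or one of them drops out, so the bound `q` does not double. -/
lemma abs_mul_add_mul_lt {q α β X Y : ℤ} (hα : |α| ≤ 1) (hβ : |β| ≤ 1) (hαβ : α * β ≤ 0)
    (hX : 0 ≤ X) (hX' : X < q) (hY : 0 ≤ Y) (hY' : Y < q) : |α * X + β * Y| < q := by
  obtain ⟨h1, h2⟩ := abs_le.1 hα
  obtain ⟨h3, h4⟩ := abs_le.1 hβ
  rw [abs_lt]
  interval_cases α <;> interval_cases β <;> constructor <;> omega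

/-- The vectors `v, w` form a basis in which every element of `V` has coordinates in `{-1, 0, 1}`.
Vectors such as `v + w` and `v - w` have determinant `±2` and cannot both occur, so the two
coordinates either never agree in sign or never oppose in sign over all of `V`. Choosing the signs
of the remainders on `v` and `w` accordingly avoids reinforcement. -/
lemma hasSmallResidues_of_abs_le_one {V : Set N} (h : ∀ v ∈ V, ∀ w ∈ V, |area b v w| ≤ 1)
    {v w : N} (hv : v ∈ V) (hw : w ∈ V) (hvw : area b v w ≠ 0) {q : ℕ} (hq : 0 < q) :
    HasSmallResidues V q := by
  intro m
  set D := area b v w with hD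
  have hD1 : |D| ≤ 1 := h v hv w hw
  have hDD : D * D = 1 := by
    obtain ⟨h1, h2⟩ := abs_le.1 hD1
    have hpm : D = 1 ∨ D = -1 := by omega
    rcases hpm with h | h <;> rw [h] <;> rfl
  have hq0 : (0 : ℤ) < q := by omega
  have expand : ∀ (e : Module.Dual ℤ N) (u : N),
      e u = (D * area b u w) * e v + (D * area b v u) * e w := by
    intro e u
    linear_combination D * area_mul_apply b e u v w - e u * hDD
  have hα : ∀ u ∈ V, |D * area b u w| ≤ 1 := fun u hu => by
    rw [abs_mul]; exact mul_le_one₀ hD1 (abs_nonneg _) (h u hu w hw)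
  have hβ : ∀ u ∈ V, |D * area b v u| ≤ 1 := fun u hu => by
    rw [abs_mul]; exact mul_le_one₀ hD1 (abs_nonneg _) (h v hv u hu)
  by_cases hsign : ∀ u ∈ V, (D * area b u w) * (D * area b v u) ≤ 0
  -- No coordinates of equal sign: both remainders are taken in `[0, q)`.
  · obtain ⟨e, he, he'⟩ := exists_dual_eq b hDD (m v / q) (m w / q)
    refine ⟨e, fun u hu => ?_⟩
    rw [expand m u, expand e u]
    convert abs_mul_add_mul_lt (X := m v - q * e v) (Y := m w - q * e w) (hα u hu) (hβ u hu)
      (hsign u hu) ?_ ?_ ?_ ?_ using 2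
    · ring
    all_goals
      simp only [he, he', ← Int.emod_def]
      first | exact Int.emod_nonneg _ hq0.ne' | exact Int.emod_lt_of_pos _ hq0
  · push Not at hsign
    obtain ⟨u₀, hu₀, hpos⟩ := hsign
    -- Rounding up on `w` puts the remainder of `m w` in `(-q, 0]`. This is the previous case for
    -- the basis `v, -w`.
    obtain ⟨e, he, he'⟩ := exists_dual_eq b hDD (m v / q) (-(-m w / q))
    refine ⟨e, fun u hu => ?_⟩
    rw [expand m u, expand e u]
    convert abs_mul_add_mul_lt (X := m v - q * e v) (Y := -m w - q * (- e w))
      (α := D * area b u w) (β := -(D * area b v u)) (hα u hu) (by rw [abs_neg]; exact hβ u hu)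
      ?_ ?_ ?_ ?_ ?_ using 2
    · ring
    -- Both coordinates of `u₀` equal the same sign, so the determinant of `u` and `u₀` is, up to
    -- sign, the difference of the coordinates of `u`. The bound `1` on it rules out opposite
    -- nonzero signs.
    · have h1 := h u hu u₀ hu₀
      have h2 : area b u u₀ = D * ((D * area b u w) * (D * area b v u₀) -
          (D * area b v u) * (D * area b u₀ w)) := by
        have h3 := area_mul_apply b (area b u) u₀ v w
        rw [area_swap b v u] at h3
        linear_combination (D * h3) - (area b u u₀) * hDD +
          (area b u₀ w * area b v u * D - area b u w * area b v u₀ * D) * hDD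
      rw [h2, abs_mul] at h1
      have hD2 : |D| = 1 := by
        rcases mul_self_eq_one_iff.1 hDD with h | h <;> rw [h] <;> simp
      rw [hD2, one_mul] at h1
      have a1 := abs_le.1 (hα u hu)
      have a2 := abs_le.1 (hβ u hu)
      have a3 := abs_le.1 (hα u₀ hu₀)
      have a4 := abs_le.1 (hβ u₀ hu₀)
      have h1' := abs_le.1 h1
      generalize D * area b u w = α at *
      generalize D * area b v u = β at *
      generalize D * area b u₀ w = α' at *
      generalize D * area b v u₀ = β' at *
      obtain ⟨a11, a12⟩ := a1
      obtain ⟨a21, a22⟩ := a2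
      obtain ⟨a31, a32⟩ := a3
      obtain ⟨a41, a42⟩ := a4
      clear h2 hα hβ expand he he'
      interval_cases α <;> interval_cases β <;> interval_cases α' <;> interval_cases β' <;> omega
    all_goals
      simp only [he, he', neg_neg, ← Int.emod_def]
      first | exact Int.emod_nonneg _ hq0.ne' | exact Int.emod_lt_of_pos _ hq0

/-- A pair of determinant `±2` spans a sublattice of index two, and primitivity forces the half sum
`f` and half difference `g` into `N`, where they form a basis. The determinants with `v` and `w`
give `|α| + |β| ≤ 2` for the coordinates of any element of `V`, and primitivity excludes `±2f` and
`±2g`. Hence both coordinates are at most `1` in size, and symmetric remainders modulo the odd `q`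
suffice. -/
lemma hasSmallResidues_of_abs_le_two {V : Set N} (hV : ∀ v ∈ V, IsPrimitive v)
    (h : ∀ v ∈ V, ∀ w ∈ V, |area b v w| ≤ 2)
    {v w : N} (hv : v ∈ V) (hw : w ∈ V) (hvw : |area b v w| = 2) {q : ℕ} (hq : Odd q) :
    HasSmallResidues V q := by
  intro m
  obtain ⟨x, hx⟩ := (hV v hv).exists_area_eq_one b
  have hwx := area_smul_eq b w v x
  rw [hx, one_smul] at hwx
  obtain ⟨ε, hε, hεε⟩ : ∃ ε : ℤ, area b v w = 2 * ε ∧ ε * ε = 1 := by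
    rcases (abs_eq (by norm_num)).1 hvw with h | h
    · exact ⟨1, by rw [h]; rfl, rfl⟩
    · exact ⟨-1, by rw [h]; rfl, rfl⟩
  -- In the basis `v, x` the second coordinate of `w` is even, so the first must be odd; otherwise
  -- `w` would be divisible by two.
  obtain ⟨c, hc⟩ : ∃ c, area b w x = 2 * c + 1 := by
    rcases Int.even_or_odd' (area b w x) with ⟨c, hc | hc⟩
    · have := (hV w hw).2 2 (c • v + ε • x) (by
        rw [hwx, hε, hc]; module)
      omega
    · exact ⟨c, hc⟩
  obtain ⟨f, hf⟩ : ∃ f, f = (c + 1) • v + ε • x := ⟨_, rfl⟩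
  obtain ⟨g, hg⟩ : ∃ g, g = (-c) • v - ε • x := ⟨_, rfl⟩
  have hvfg : v = f + g := by rw [hf, hg]; module
  have hwfg : w = f - g := by rw [hf, hg, hwx, hc, hε]; module
  have hfg : area b f g = -ε := by
    have : area b v w = -2 * area b f g := by
      rw [hvfg, hwfg]
      simp only [map_add, map_sub, LinearMap.add_apply, area_self, area_swap b f g]
      ring
    linarith
  have hone : area b f g * area b f g = 1 := by rw [hfg]; linarith
  have expand : ∀ u : N, u = (-ε * area b u g) • f + (-ε * area b f u) • g := by
    intro u
    have := congrArg (fun y => -ε • y) (area_smul_eq b u f g)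
    simp only [hfg, smul_add, smul_smul] at this
    rwa [show -ε * -ε = 1 by linarith, one_smul] at this
  obtain ⟨k, hk⟩ := hq
  have hq0 : (0 : ℤ) < q := by omega
  -- Since `q = 2k + 1`, remainders can be taken in `[-k, k]`, and two of them add up to at most `2k
  -- < q`.
  have hres : ∀ a : ℤ, ∃ s : ℤ, |a - q * s| ≤ k := by
    intro a
    refine ⟨(a + k) / q, ?_⟩
    have h1 := Int.emod_nonneg (a + k) hq0.ne'
    have h2 := Int.emod_lt_of_pos (a + k) hq0
    rw [Int.emod_def] at h1 h2
    rw [abs_le]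
    constructor <;> omega
  obtain ⟨s, hs⟩ := hres (m f)
  obtain ⟨t, ht⟩ := hres (m g)
  obtain ⟨e, rfl, rfl⟩ := exists_dual_eq b hone s t
  refine ⟨e, fun u hu => ?_⟩
  have h1 := h v hv u hu
  have h2 := h w hw u hu
  have hup := hV u hu
  have hεabs : |ε| = 1 := by
    rcases mul_self_eq_one_iff.1 hεε with h | h <;> rw [h] <;> simp
  have hu := expand u
  have h1' : area b v u = -ε * (-ε * area b f u - -ε * area b u g) := by
    rw [hvfg, map_add, LinearMap.add_apply, area_swap b u g]
    linear_combination -(area b f u - area b u g) * hεε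
  have h2' : area b w u = -ε * (-ε * area b f u + -ε * area b u g) := by
    rw [hwfg, map_sub, LinearMap.sub_apply, area_swap b u g]
    linear_combination -(area b f u + area b u g) * hεε
  generalize -ε * area b u g = α at *
  generalize -ε * area b f u = β at *
  rw [h1', abs_mul, abs_neg, hεabs, one_mul] at h1
  rw [h2', abs_mul, abs_neg, hεabs, one_mul] at h2
  have key : |α| ≤ 1 ∧ |β| ≤ 1 := by
    rw [abs_le] at h1 h2
    by_contra hcon
    have hcases : (α = 2 ∧ β = 0) ∨ (α = -2 ∧ β = 0) ∨ (α = 0 ∧ β = 2) ∨ (α = 0 ∧ β = -2) := by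
      rw [abs_le, abs_le] at hcon
      omega
    have : (2 : ℕ) = 1 := by
      rcases hcases with ⟨rfl, rfl⟩ | ⟨rfl, rfl⟩ | ⟨rfl, rfl⟩ | ⟨rfl, rfl⟩
      · exact hup.2 2 f (by rw [hu]; module)
      · exact hup.2 2 (-f) (by rw [hu]; module)
      · exact hup.2 2 g (by rw [hu]; module)
      · exact hup.2 2 (-g) (by rw [hu]; module)
    omega
  have hval : m u - q * e u = α * (m f - q * e f) + β * (m g - q * e g) := by
    conv_lhs => rw [hu]
    simp only [map_add, map_smul, smul_eq_mul]
    ring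
  rw [hval]
  calc _ ≤ |α * (m f - q * e f)| + |β * (m g - q * e g)| := abs_add_le _ _
    _ ≤ k + k := by
      rw [abs_mul, abs_mul]
      gcongr
      · exact (mul_le_of_le_one_left (abs_nonneg _) key.1).trans hs
      · exact (mul_le_of_le_one_left (abs_nonneg _) key.2).trans ht
    _ < q := by omega

end Plane

/-! ### Unimodularity and 2-regularity in terms of determinants -/

section Configurations

variable {N : Type u} [AddCommGroup N] (b : Module.Basis (Fin 2) ℤ N)

lemma linearIndepOn_pair_of_area_ne_zero {v w : N} (h : area b v w ≠ 0) :
    LinearIndepOn ℤ id {v, w} := by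
  have hne : v ≠ w := by
    rintro rfl
    exact h (area_self b v)
  rw [LinearIndepOn.pair_iff _ hne]
  intro c d hcd
  simp only [id] at hcd
  have h1 := congrArg (area b v) hcd
  have h2 := congrArg (area b w) hcd
  simp only [map_add, map_smul, area_self, area_swap b v w, smul_eq_mul, map_zero] at h1 h2
  constructor
  · simpa [h] using h2
  · simpa [h] using h1

lemma area_ne_zero_of_linearIndepOn_pair {v w : N} (hne : v ≠ w)
    (h : LinearIndepOn ℤ id {v, w}) : area b v w ≠ 0 := by
  intro h0
  rw [LinearIndepOn.pair_iff _ hne] at h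
  rw [area_apply] at h0
  obtain ⟨h1, h2⟩ := h (b.coord 0 w) (-b.coord 0 v) (by
    apply coord_injective b <;> simp only [id, map_add, map_smul, smul_eq_mul, map_zero] <;>
      linarith)
  obtain ⟨h3, h4⟩ := h (b.coord 1 w) (-b.coord 1 v) (by
    apply coord_injective b <;> simp only [id, map_add, map_smul, smul_eq_mul, map_zero] <;>
      linarith)
  exact hne (coord_injective b (by linarith) (by linarith))

lemma isMaxIndep_pair {V : Set N} {v w : N} (hv : v ∈ V) (hw : w ∈ V) (h : area b v w ≠ 0) :
    IsMaxIndep V {v, w} := by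
  classical
  have : Module.Finite ℤ N := Module.Finite.of_basis b
  have hrank : Module.finrank ℤ N = 2 := by simp [Module.finrank_eq_card_basis b]
  refine ⟨⟨Set.insert_subset hv (Set.singleton_subset_iff.2 hw),
    linearIndepOn_pair_of_area_ne_zero b h⟩, ?_⟩
  rintro C ⟨-, hC⟩ hle u hu
  by_contra hu'
  have hne : v ≠ w := by
    rintro rfl
    exact h (area_self b v)
  simp only [Set.mem_insert_iff, Set.mem_singleton_iff, not_or] at hu'
  have hsub : (({u, v, w} : Finset N) : Set N) ⊆ C := by
    simp only [Finset.coe_insert, Finset.coe_singleton]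
    exact Set.insert_subset hu hle
  have hcard := LinearIndependent.finset_card_le_finrank (hC.mono hsub)
  rw [hrank, Finset.card_insert_of_notMem (by simp [hu'.1, hu'.2]), Finset.card_pair hne] at hcard
  omega

/-- Once `V` spans the plane, a single nonzero vector of `V` can always be completed by another
element of `V`, so a maximal independent set cannot have fewer than two elements. -/
lemma IsMaxIndep.exists_area_ne_zero {V B : Set N} (hB : IsMaxIndep V B) {v w : N} (hv : v ∈ V)
    (hw : w ∈ V) (h : area b v w ≠ 0) : ∃ x ∈ B, ∃ y ∈ B, area b x y ≠ 0 := by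
  have hother : ∀ x : N, x ≠ 0 → ∃ y ∈ V, area b x y ≠ 0 := by
    intro x hx
    by_contra! hcon
    apply hx
    have h1 := area_smul_eq b x v w
    rw [hcon w hw, area_swap b x v, hcon v hv] at h1
    exact eq_zero_of_smul_eq_zero b h (by simpa using h1)
  have hne0 : v ≠ 0 := by
    rintro rfl
    simp at h
  obtain ⟨x, hx⟩ : B.Nonempty := by
    rw [Set.nonempty_iff_ne_empty]
    rintro rfl
    have hind : LinearIndepOn ℤ id {v} :=
      (linearIndepOn_pair_of_area_ne_zero b h).mono (by simp)
    exact hB.2 ⟨Set.singleton_subset_iff.2 hv, hind⟩ (Set.empty_subset _) rfl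
  have hx0 : x ≠ 0 := hB.1.2.ne_zero hx
  refine ⟨x, hx, ?_⟩
  by_contra! hcon
  have hBx : B = {x} := by
    refine Set.Subset.antisymm (fun y hy => ?_) (Set.singleton_subset_iff.2 hx)
    by_contra hyx
    exact area_ne_zero_of_linearIndepOn_pair b (Ne.symm hyx)
      (hB.1.2.mono (Set.insert_subset hx (Set.singleton_subset_iff.2 hy))) (hcon y hy)
  obtain ⟨y, hy, hxy⟩ := hother x hx0
  have hyB : y ∈ B := hB.2 ⟨Set.insert_subset (hB.1.1 hx) (Set.singleton_subset_iff.2 hy),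
    linearIndepOn_pair_of_area_ne_zero b hxy⟩ (by rw [hBx]; simp) (by simp)
  exact hxy (hcon y hyB)

/-- Two vectors generate the lattice exactly when their determinant is a unit. The spanning
assumption excludes maximal independent sets of smaller size. -/
lemma isUnimodular_iff {V : Set N} (hV : ∃ v ∈ V, ∃ w ∈ V, area b v w ≠ 0) :
    IsUnimodular V ↔ ∀ v ∈ V, ∀ w ∈ V, |area b v w| ≤ 1 := by
  constructor
  · intro h v hv w hw
    by_cases h0 : area b v w = 0
    · simp [h0]
    have hspan := h _ (isMaxIndep_pair b hv hw h0)
    have h1 : b 0 ∈ Submodule.span ℤ {v, w} := hspan ▸ Submodule.mem_top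
    have h2 : b 1 ∈ Submodule.span ℤ {v, w} := hspan ▸ Submodule.mem_top
    rw [Submodule.mem_span_pair] at h1 h2
    obtain ⟨p, q, h1⟩ := h1
    obtain ⟨r, s, h2⟩ := h2
    have h3 : area b (b 0) (b 1) = 1 := by simp [area_apply]
    rw [← h1, ← h2] at h3
    simp only [map_add, map_smul, LinearMap.add_apply, LinearMap.smul_apply, area_self,
      area_swap b v w, smul_eq_mul] at h3
    have h4 : IsUnit (area b v w) :=
      IsUnit.of_mul_eq_one (p * s - q * r) (by linarith)
    rcases Int.isUnit_iff.1 h4 with h | h <;> rw [h] <;> simp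
  · intro h B hB
    obtain ⟨v, hv, w, hw, hvw⟩ := hV
    obtain ⟨x, hx, y, hy, hxy⟩ := hB.exists_area_ne_zero b hv hw hvw
    rw [eq_top_iff]
    intro u _
    have h1 := area_smul_eq b u x y
    have h2 : area b x y • u ∈ Submodule.span ℤ B := by
      rw [h1]
      exact add_mem (Submodule.smul_mem _ _ (Submodule.subset_span hx))
        (Submodule.smul_mem _ _ (Submodule.subset_span hy))
    have h3 := abs_le.1 (h x (hB.1.1 hx) y (hB.1.1 hy))
    have h4 : area b x y = 1 ∨ area b x y = -1 := by omega
    rcases h4 with h4 | h4 <;> simpa [h4] using h2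

/-- If `v` is primitive and `det(v, x) = 1`, then `det(v, ·)` identifies `N / ⟨v, w⟩` with a cyclic
group of order `|det(v, w)|`, so it is killed by two exactly when the determinant divides two. -/
lemma isRegular_two_iff {V : Set N} (hprim : ∀ v ∈ V, IsPrimitive v)
    (hV : ∃ v ∈ V, ∃ w ∈ V, area b v w ≠ 0) :
    IsRegular 2 V ↔ ∀ v ∈ V, ∀ w ∈ V, |area b v w| ≤ 2 := by
  constructor
  · intro h v hv w hw
    by_cases h0 : area b v w = 0
    · simp [h0]
    obtain ⟨x, hx⟩ := (hprim v hv).exists_area_eq_one b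
    have h1 := h _ (isMaxIndep_pair b hv hw h0) (Submodule.Quotient.mk x)
    rw [← Submodule.Quotient.mk_smul, Submodule.Quotient.mk_eq_zero,
      Submodule.mem_span_pair] at h1
    obtain ⟨p, q, h1⟩ := h1
    have h2 := congrArg (area b v) h1
    rw [map_add, map_smul, map_smul, map_nsmul, area_self, hx, smul_eq_mul, smul_eq_mul] at h2
    have h3 : area b v w ∣ 2 := ⟨q, by rw [mul_comm]; simpa using h2.symm⟩
    exact Int.le_of_dvd (by norm_num) ((abs_dvd _ _).2 h3)
  · intro h B hB z
    obtain ⟨v, hv, w, hw, hvw⟩ := hV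
    obtain ⟨x, hx, y, hy, hxy⟩ := hB.exists_area_ne_zero b hv hw hvw
    obtain ⟨u, rfl⟩ := Submodule.Quotient.mk_surjective _ z
    rw [← Submodule.Quotient.mk_smul, Submodule.Quotient.mk_eq_zero]
    have h1 := area_smul_eq b u x y
    have h2 : area b x y • u ∈ Submodule.span ℤ B := by
      rw [h1]
      exact add_mem (Submodule.smul_mem _ _ (Submodule.subset_span hx))
        (Submodule.smul_mem _ _ (Submodule.subset_span hy))
    have h3 := abs_le.1 (h x (hB.1.1 hx) y (hB.1.1 hy))
    obtain ⟨c, hc⟩ : ∃ c : ℤ, (2 : ℤ) = c * area b x y := by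
      have h4 : area b x y = 1 ∨ area b x y = -1 ∨ area b x y = 2 ∨ area b x y = -2 := by omega
      rcases h4 with h4 | h4 | h4 | h4 <;> rw [h4]
      exacts [⟨2, rfl⟩, ⟨-2, rfl⟩, ⟨1, rfl⟩, ⟨-1, rfl⟩]
    have h5 : (2 : ℕ) • u = c • (area b x y • u) := by
      rw [smul_smul, ← hc]
      exact (natCast_zsmul u 2).symm
    rw [h5]
    exact Submodule.smul_mem _ _ h2

end Configurations

/-! ### Cones of a plane fan -/

section Cones

variable {N : Type u} [AddCommGroup N]

lemma pairing_tmul (m : Module.Dual ℤ N) (r : ℝ) (v : N) :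
    pairing m (r ⊗ₜ[ℤ] v) = r * m v := by
  simp [pairing, mul_comm]

lemma mem_latticeCone {s : Set N} {v : N} (hv : v ∈ s) : (1 : ℝ) ⊗ₜ[ℤ] v ∈ latticeCone s :=
  Submodule.subset_span ⟨v, hv, rfl⟩

lemma smul_mem_cone {σ : PointedCone ℝ (RealSpace N)} {r : ℝ} (hr : 0 ≤ r) {x : RealSpace N}
    (hx : x ∈ σ) : r • x ∈ σ :=
  Submodule.smul_mem σ (⟨r, hr⟩ : {r : ℝ // 0 ≤ r}) hx

lemma latticeCone_le {s : Set N} {σ : PointedCone ℝ (RealSpace N)}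
    (h : ∀ v ∈ s, (1 : ℝ) ⊗ₜ[ℤ] v ∈ σ) : latticeCone s ≤ σ := by
  refine Submodule.span_le.2 ?_
  rintro _ ⟨v, hv, rfl⟩
  exact h v hv

lemma mem_dualMonoid_latticeCone {s : Set N} {m : Module.Dual ℤ N} :
    m ∈ dualMonoid (latticeCone s) ↔ ∀ v ∈ s, 0 ≤ m v := by
  constructor
  · intro h v hv
    have := h _ (mem_latticeCone hv)
    rw [pairing_tmul, one_mul] at this
    exact_mod_cast this
  · intro h x hx
    refine Submodule.span_induction (p := fun x _ => 0 ≤ pairing m x) ?_ ?_ ?_ ?_ hx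
    · rintro _ ⟨v, hv, rfl⟩
      simp only [pairing_tmul, one_mul]
      exact_mod_cast h v hv
    · simp
    · intro a b _ _ ha hb
      rw [map_add]
      exact add_nonneg ha hb
    · intro c a _ ha
      have : c • a = (c : ℝ) • a := rfl
      rw [this, map_smul]
      exact mul_nonneg c.2 ha

variable (b : Module.Basis (Fin 2) ℤ N)

lemma one_tmul_eq_zero (b : Module.Basis (Fin 2) ℤ N) {v : N} (h : (1 : ℝ) ⊗ₜ[ℤ] v = 0) :
    v = 0 := by
  have key : ∀ i, b.coord i v = 0 := by
    intro i
    have := congrArg (pairing (b.coord i)) h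
    rw [pairing_tmul, one_mul, map_zero] at this
    exact_mod_cast this
  exact coord_injective b (by rw [key, map_zero]) (by rw [key, map_zero])

/-- A strongly convex cone contains no positive relation between nonzero lattice points. -/
lemma eq_zero_of_positive_relation (b : Module.Basis (Fin 2) ℤ N)
    {σ : PointedCone ℝ (RealSpace N)} (hσ : ∀ x ∈ σ, -x ∈ σ → x = 0)
    {u v w : N} (hu : (1 : ℝ) ⊗ₜ[ℤ] u ∈ σ) (hv : (1 : ℝ) ⊗ₜ[ℤ] v ∈ σ) (hw : (1 : ℝ) ⊗ₜ[ℤ] w ∈ σ)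
    {p q r : ℤ} (hp : 0 < p) (hq : 0 ≤ q) (hr : 0 ≤ r) (h : p • u + q • v + r • w = 0) :
    u = 0 := by
  have cast : ∀ (n : ℤ) (x : N), (1 : ℝ) ⊗ₜ[ℤ] (n • x) = (n : ℝ) • ((1 : ℝ) ⊗ₜ[ℤ] x) := by
    intro n x
    rw [TensorProduct.tmul_smul, Int.cast_smul_eq_zsmul]
  have h1 := congrArg (fun x : N => (1 : ℝ) ⊗ₜ[ℤ] x) h
  simp only [TensorProduct.tmul_add, cast, TensorProduct.tmul_zero] at h1
  have hp' : (0 : ℝ) < p := by exact_mod_cast hp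
  have hq' : (0 : ℝ) ≤ q := by exact_mod_cast hq
  have hr' : (0 : ℝ) ≤ r := by exact_mod_cast hr
  have h2 := hσ _ (smul_mem_cone hp'.le hu) (by
    have h3 : -((p : ℝ) • (1 : ℝ) ⊗ₜ[ℤ] u) =
        (q : ℝ) • (1 : ℝ) ⊗ₜ[ℤ] v + (r : ℝ) • (1 : ℝ) ⊗ₜ[ℤ] w :=
      neg_eq_of_add_eq_zero_right (by rw [← add_assoc]; exact h1)
    rw [h3]
    exact add_mem (smul_mem_cone hq' hv) (smul_mem_cone hr' hw))
  exact one_tmul_eq_zero b ((smul_eq_zero_iff_right hp'.ne').1 h2)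

/-- Stated for a relation that need not be antisymmetric, because it is applied to the angular order
`det(x, y) ≥ 0`, for which parallel vectors are tied. -/
lemma exists_le_of_total {α : Type*} (r : α → α → Prop) (s : Finset α) (hs : s.Nonempty)
    (htotal : ∀ x ∈ s, ∀ y ∈ s, r x y ∨ r y x)
    (htrans : ∀ x ∈ s, ∀ y ∈ s, ∀ z ∈ s, r x y → r y z → r x z) :
    ∃ x ∈ s, ∀ y ∈ s, r x y := by
  classical
  induction hs using Finset.Nonempty.cons_induction with
  | singleton a =>
    refine ⟨a, by simp, fun y hy => ?_⟩
    obtain rfl := Finset.mem_singleton.1 hy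
    exact (htotal y (by simp) y (by simp)).elim id id
  | cons a s ha hs ih =>
    obtain ⟨x, hx, hmin⟩ := ih
      (fun x hx y hy => htotal x (Finset.mem_cons_of_mem hx) y (Finset.mem_cons_of_mem hy))
      (fun x hx y hy z hz => htrans x (Finset.mem_cons_of_mem hx) y (Finset.mem_cons_of_mem hy) z
        (Finset.mem_cons_of_mem hz))
    have haa : a ∈ Finset.cons a s ha := Finset.mem_cons_self _ _
    have hxs : x ∈ Finset.cons a s ha := Finset.mem_cons_of_mem hx
    rcases htotal a haa x hxs with h | h
    · refine ⟨a, haa, fun y hy => ?_⟩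
      rcases Finset.mem_cons.1 hy with rfl | hy'
      · exact (htotal y hy y hy).elim id id
      · exact htrans a haa x hxs y hy h (hmin y hy')
    · refine ⟨x, hxs, fun y hy => ?_⟩
      rcases Finset.mem_cons.1 hy with rfl | hy'
      · exact h
      · exact hmin y hy'

lemma tmul_combination {v w : N} (x : RealSpace N) :
    (area b v w : ℝ) • x = pairing (-area b w) x • ((1 : ℝ) ⊗ₜ[ℤ] v) +
      pairing (area b v) x • ((1 : ℝ) ⊗ₜ[ℤ] w) := by
  induction x using TensorProduct.induction_on with
  | zero => simp
  | add x y hx hy =>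
    rw [smul_add, hx, hy]
    simp only [map_add, add_smul]
    abel
  | tmul r u =>
    have h := congrArg (fun y : N => r • ((1 : ℝ) ⊗ₜ[ℤ] y)) (area_smul_eq b u v w)
    have cast : ∀ (n : ℤ) (y : N), (1 : ℝ) ⊗ₜ[ℤ] (n • y) = (n : ℝ) • ((1 : ℝ) ⊗ₜ[ℤ] y) := by
      intro n x
      rw [TensorProduct.tmul_smul, Int.cast_smul_eq_zsmul]
    simp only [TensorProduct.tmul_add, cast] at h
    have hr : r ⊗ₜ[ℤ] u = r • ((1 : ℝ) ⊗ₜ[ℤ] u) := by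
      rw [TensorProduct.smul_tmul', smul_eq_mul, mul_one]
    simp only [pairing_tmul, LinearMap.neg_apply, ← area_swap b w u]
    rw [hr, smul_comm, h, smul_add, smul_smul, smul_smul]

/-- A ray of a cone that is cut out by a nonnegative functional is a face. -/
lemma isFace_ray {σ : PointedCone ℝ (RealSpace N)} {v w : N} {μ ν : Module.Dual ℤ N} {a : ℝ}
    (ha : 0 < a) (hv : (1 : ℝ) ⊗ₜ[ℤ] v ∈ σ) (hμ : μ ∈ dualMonoid σ) (hν : ν ∈ dualMonoid σ)
    (hμv : μ v = 0) (h : ∀ x, a • x = pairing ν x • ((1 : ℝ) ⊗ₜ[ℤ] v) +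
      pairing μ x • ((1 : ℝ) ⊗ₜ[ℤ] w)) : IsFace (latticeCone {v}) σ := by
  refine ⟨μ, hμ, fun x => ⟨fun hx => ⟨?_, ?_⟩, ?_⟩⟩
  · exact latticeCone_le (by simpa using hv) hx
  · have h1 : μ ∈ dualMonoid (latticeCone {v}) := by
      rw [mem_dualMonoid_latticeCone]; simp [hμv]
    have h2 : -μ ∈ dualMonoid (latticeCone {v}) := by
      rw [mem_dualMonoid_latticeCone]; simp [hμv]
    have h3 := h1 x hx
    have h4 := h2 x hx
    simp only [pairing, map_neg, LinearMap.neg_apply] at h3 h4 ⊢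
    linarith
  · rintro ⟨hx, h0⟩
    have h1 := h x
    rw [h0, zero_smul, add_zero] at h1
    have h2 : x = (a⁻¹ * pairing ν x) • ((1 : ℝ) ⊗ₜ[ℤ] v) := by
      rw [mul_smul, ← h1, smul_smul, inv_mul_cancel₀ ha.ne', one_smul]
    rw [h2]
    exact smul_mem_cone (mul_nonneg (inv_nonneg.2 ha.le) (hν x hx)) (mem_latticeCone rfl)

lemma latticeCone_singleton_nsmul {d : ℕ} (hd : 0 < d) (v : N) :
    latticeCone {d • v} = latticeCone {v} := by
  have hd' : (0 : ℝ) < d := by exact_mod_cast hd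
  have h : (1 : ℝ) ⊗ₜ[ℤ] (d • v) = (d : ℝ) • ((1 : ℝ) ⊗ₜ[ℤ] v) := by
    rw [TensorProduct.tmul_smul, Nat.cast_smul_eq_nsmul]
  apply le_antisymm
  · refine latticeCone_le ?_
    rintro _ rfl
    rw [h]
    exact smul_mem_cone hd'.le (mem_latticeCone rfl)
  · have h2 := smul_mem_cone (inv_nonneg.2 hd'.le) (mem_latticeCone (Set.mem_singleton (d • v)))
    rw [h, smul_smul, inv_mul_cancel₀ hd'.ne', one_smul] at h2
    exact latticeCone_le (by simpa using h2)

/-- A lattice point spanning a ray of the fan is a positive multiple of a primitive generator. -/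
lemma Fan.apply_nonneg_of_latticeCone_mem (b : Module.Basis (Fin 2) ℤ N) (S : Fan N)
    {σ : PointedCone ℝ (RealSpace N)} {v : N} (hv0 : v ≠ 0) (hvσ : (1 : ℝ) ⊗ₜ[ℤ] v ∈ σ)
    (hv : latticeCone {v} ∈ S.cones) {m : Module.Dual ℤ N}
    (hm : ∀ v ∈ S.rays, (1 : ℝ) ⊗ₜ[ℤ] v ∈ σ → 0 ≤ m v) : 0 ≤ m v := by
  obtain ⟨d, w, hd, hw, rfl⟩ := exists_isPrimitive b hv0
  have hwr : w ∈ S.rays := ⟨hw, by rwa [latticeCone_singleton_nsmul hd] at hv⟩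
  have hwσ : (1 : ℝ) ⊗ₜ[ℤ] w ∈ σ := by
    have h1 : latticeCone {d • w} ≤ σ := latticeCone_le (by simpa using hvσ)
    rw [latticeCone_singleton_nsmul hd] at h1
    exact h1 (mem_latticeCone rfl)
  rw [map_nsmul]
  exact nsmul_nonneg (hm w hwr hwσ) d

/-- In a plane fan, `σ^∨ ∩ M` is cut out by the primitive generators of the rays of `σ`. -/
lemma Fan.mem_dualMonoid (b : Module.Basis (Fin 2) ℤ N) (S : Fan N)
    {σ : PointedCone ℝ (RealSpace N)} (hσ : σ ∈ S.cones) {m : Module.Dual ℤ N}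
    (hm : ∀ v ∈ S.rays, (1 : ℝ) ⊗ₜ[ℤ] v ∈ σ → 0 ≤ m v) : m ∈ dualMonoid σ := by
  classical
  obtain ⟨s, hs, hσs⟩ := S.rational σ hσ
  have hconv := S.strongly_convex σ hσ
  have hmem : ∀ v ∈ s, (1 : ℝ) ⊗ₜ[ℤ] v ∈ σ := fun v hv => hσs ▸ mem_latticeCone hv
  suffices H : ∀ u ∈ s, u ≠ 0 → 0 ≤ m u by
    rw [hσs, mem_dualMonoid_latticeCone]
    intro u hu
    by_cases h0 : u = 0
    · simp [h0]
    · exact H u hu h0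
  let t := hs.toFinset.erase 0
  have ht : ∀ {u}, u ∈ t ↔ u ≠ 0 ∧ u ∈ s := by simp [t]
  -- Nonnegative determinant is not transitive in the plane, but it is inside a strongly convex
  -- cone: a failure turns Cramer's rule into a positive relation among generators.
  have htrans : ∀ x ∈ t, ∀ y ∈ t, ∀ z ∈ t, 0 ≤ area b x y → 0 ≤ area b y z → 0 ≤ area b x z := by
    intro x hx y hy z hz hxy hyz
    by_contra! hxz
    refine (ht.1 hy).1 (eq_zero_of_positive_relation b hconv (hmem y (ht.1 hy).2)
      (hmem x (ht.1 hx).2) (hmem z (ht.1 hz).2) (neg_pos.2 hxz) hyz hxy ?_)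
    have := area_smul_eq b y x z
    rw [neg_smul, this]
    abel
  have htotal : ∀ x ∈ t, ∀ y ∈ t, 0 ≤ area b x y ∨ 0 ≤ area b y x := by
    intro x _ y _
    rw [area_swap b x y]
    omega
  intro u hu hu0
  have hut : u ∈ t := ht.2 ⟨hu0, hu⟩
  -- `v` and `w` are the generators at the two angular ends of the cone.
  obtain ⟨v, hvt, hv⟩ := exists_le_of_total (fun x y => 0 ≤ area b x y) t ⟨u, hut⟩ htotal htrans
  obtain ⟨w, hwt, hw⟩ := exists_le_of_total (fun x y => 0 ≤ area b y x) t ⟨u, hut⟩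
    (fun x hx y hy => htotal y hy x hx)
    (fun x hx y hy z hz hxy hyz => htrans z hz y hy x hx hyz hxy)
  have hvσ : area b v ∈ dualMonoid σ := by
    rw [hσs, mem_dualMonoid_latticeCone]
    intro x hx
    by_cases h0 : x = 0
    · simp [h0]
    · exact hv x (ht.2 ⟨h0, hx⟩)
  have hwσ : -area b w ∈ dualMonoid σ := by
    rw [hσs, mem_dualMonoid_latticeCone]
    intro x hx
    rw [LinearMap.neg_apply, ← area_swap]
    by_cases h0 : x = 0
    · simp [h0]
    · exact hw x (ht.2 ⟨h0, hx⟩)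
  have hvs := hmem v (ht.1 hvt).2
  have hws := hmem w (ht.1 hwt).2
  -- If the ends are parallel, all generators lie on one line and, by strong convexity, on one ray,
  -- so `σ` is itself a ray of the fan. Otherwise `det(v, ·)` and `-det(w, ·)` cut out the two
  -- boundary rays as faces, and each generator is a nonnegative rational combination of `v` and
  -- `w`.
  rcases (hv w hwt).eq_or_lt with h0 | hpos
  · have hall : ∀ x ∈ t, area b v x = 0 := by
      intro x hx
      have h1 := hv x hx
      have h2 := htrans x hx w hwt v hvt (hw x hx) (by rw [area_swap b v w, ← h0]; simp)
      rw [area_swap b v x] at h2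
      omega
    obtain ⟨d, v', hd, hv', hvv'⟩ := exists_isPrimitive b (ht.1 hvt).1
    have hcone : latticeCone {v} = σ := by
      apply le_antisymm (latticeCone_le (by simpa using hvs))
      conv_lhs => rw [hσs]
      refine latticeCone_le fun x hx => ?_
      by_cases hx0 : x = 0
      · simp [hx0]
      have hxt := ht.2 ⟨hx0, hx⟩
      have h1 := hall x hxt
      rw [hvv', map_nsmul, LinearMap.smul_apply, nsmul_eq_mul, mul_eq_zero] at h1
      obtain ⟨c, hc⟩ := exists_eq_smul_of_area_eq_zero b hv' (h1.resolve_left (by omega))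
      have hc0 : 0 ≤ c := by
        by_contra! hneg
        refine hx0 (eq_zero_of_positive_relation b hconv (hmem x hx) hvs hvs
          (p := d) (q := -c) (r := 0) (by omega) (by omega) le_rfl ?_)
        rw [hc, hvv']
        module
      rw [hvv', latticeCone_singleton_nsmul hd, hc, TensorProduct.tmul_smul,
        ← Int.cast_smul_eq_zsmul ℝ]
      exact smul_mem_cone (by exact_mod_cast hc0) (mem_latticeCone rfl)
    have hmσ : m ∈ dualMonoid σ := by
      conv => rw [← hcone]
      rw [mem_dualMonoid_latticeCone]
      rintro _ rfl
      exact S.apply_nonneg_of_latticeCone_mem b (ht.1 hvt).1 hvs (by rwa [hcone]) hm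
    rw [hσs, mem_dualMonoid_latticeCone] at hmσ
    exact hmσ u hu
  · have hpos' : (0 : ℝ) < area b v w := by exact_mod_cast hpos
    have hmv : 0 ≤ m v := S.apply_nonneg_of_latticeCone_mem b (ht.1 hvt).1 hvs
      (S.face_mem σ hσ _ (isFace_ray hpos' hvs hvσ hwσ (area_self b v) (tmul_combination b))) hm
    have hmw : 0 ≤ m w := S.apply_nonneg_of_latticeCone_mem b (ht.1 hwt).1 hws
      (S.face_mem σ hσ _ (isFace_ray (w := v) hpos' hws hwσ hvσ (by simp [area_self])
        fun x => (tmul_combination b x).trans (add_comm _ _))) hm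
    have h1 := area_mul_apply b m u v w
    have h2 := mul_nonneg (hw u hut) hmv
    have h3 := mul_nonneg (hv u hut) hmw
    exact nonneg_of_mul_nonneg_right (h1 ▸ add_nonneg h2 h3) hpos

/-- The rays of a complete plane fan span the plane. -/
lemma Fan.IsComplete.exists_area_ne_zero {S : Fan N} (hS : S.IsComplete) :
    ∃ v ∈ S.rays, ∃ w ∈ S.rays, area b v w ≠ 0 := by
  by_contra! hcon
  -- If all rays were on a line, some nonzero `m` would vanish on them. Then `m` and `-m` lie in the
  -- dual of every cone, and completeness forces `m = 0`.
  obtain ⟨m, hm0, hm⟩ : ∃ m : Module.Dual ℤ N, m ≠ 0 ∧ ∀ v ∈ S.rays, m v = 0 := by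
    rcases S.rays.eq_empty_or_nonempty with h | ⟨v, hv⟩
    · refine ⟨b.coord 0, fun h0 => ?_, by simp [h]⟩
      simpa using LinearMap.congr_fun h0 (b 0)
    · obtain ⟨w, hw⟩ := hv.1.exists_area_eq_one b
      refine ⟨area b v, fun h0 => ?_, hcon v hv⟩
      simp [h0] at hw
  apply hm0
  ext u
  obtain ⟨σ, hσ, hu⟩ := hS ((1 : ℝ) ⊗ₜ[ℤ] u)
  have h1 := S.mem_dualMonoid b hσ (m := m) (fun v hv _ => (hm v hv).ge) _ hu
  have h2 := S.mem_dualMonoid b hσ (m := -m) (fun v hv _ => by simp [hm v hv]) _ hu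
  rw [pairing_tmul, one_mul] at h1 h2
  have h1' : 0 ≤ m u := by exact_mod_cast h1
  have h2' : 0 ≤ (-m) u := by exact_mod_cast h2
  rw [LinearMap.neg_apply] at h2'
  simp only [LinearMap.zero_apply]
  omega

end Cones

/-! ### The coordinate ring of the torus `T × T` -/

section TorusSquare

/-- The coordinate ring `k[M × M]` of the square of the torus. -/
abbrev TorusRing (k N : Type u) [Field k] [AddCommGroup N] : Type u :=
  AddMonoidAlgebra k (Module.Dual ℤ N × Module.Dual ℤ N)

variable (k : Type u) [Field k] {N : Type u} [AddCommGroup N]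

/-- The restriction of functions on `U_σ × U_τ` to the torus. -/
noncomputable def squareChart (σ τ : PointedCone ℝ (RealSpace N)) :
    ChartRing k σ ⊗[k] ChartRing k τ →ₐ[k] TorusRing k N :=
  Algebra.TensorProduct.productMap
    (AddMonoidAlgebra.mapDomainAlgHom k k
      ((AddMonoidHom.inl _ _).comp (dualMonoid σ).subtype))
    (AddMonoidAlgebra.mapDomainAlgHom k k
      ((AddMonoidHom.inr _ _).comp (dualMonoid τ).subtype))

variable {k}

lemma squareChart_single {σ τ : PointedCone ℝ (RealSpace N)} (m : dualMonoid σ)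
    (n : dualMonoid τ) (a c : k) :
    squareChart k σ τ (AddMonoidAlgebra.single m a ⊗ₜ AddMonoidAlgebra.single n c) =
      AddMonoidAlgebra.single (m.1, n.1) (a * c) := by
  simp [squareChart, AddMonoidAlgebra.single_mul_single]

lemma squareChart_hom_ext {σ τ : PointedCone ℝ (RealSpace N)} {A : Type*} [Semiring A]
    [Algebra k A] {f g : ChartRing k σ ⊗[k] ChartRing k τ →ₐ[k] A}
    (h : ∀ m n, f (AddMonoidAlgebra.single m 1 ⊗ₜ AddMonoidAlgebra.single n 1) =
      g (AddMonoidAlgebra.single m 1 ⊗ₜ AddMonoidAlgebra.single n 1)) : f = g := by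
  refine Algebra.TensorProduct.ext' fun x y => ?_
  induction x using AddMonoidAlgebra.induction_linear with
  | zero => simp
  | add x x' hx hx' => rw [TensorProduct.add_tmul, map_add, map_add, hx, hx']
  | single m a =>
    induction y using AddMonoidAlgebra.induction_linear with
    | zero => simp
    | add y y' hy hy' => rw [TensorProduct.tmul_add, map_add, map_add, hy, hy']
    | single n c =>
      have key : (AddMonoidAlgebra.single m a : ChartRing k σ) ⊗ₜ[k]
          (AddMonoidAlgebra.single n c : ChartRing k τ) =
          (a * c) • (AddMonoidAlgebra.single m 1 ⊗ₜ[k] AddMonoidAlgebra.single n 1) := by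
        rw [mul_smul, ← TensorProduct.tmul_smul, TensorProduct.smul_tmul']
        simp
      rw [key, map_smul, map_smul, h]

/-- Writing restriction to the torus as a relabelling of exponents makes both injectivity and the
description of the image immediate. -/
lemma squareChart_eq (σ τ : PointedCone ℝ (RealSpace N))
    (x : ChartRing k σ ⊗[k] ChartRing k τ) :
    squareChart k σ τ x = AddMonoidAlgebra.mapDomain
      (Prod.map (Subtype.val : dualMonoid σ → _) (Subtype.val : dualMonoid τ → _))
      (AddMonoidAlgebra.tensorEquiv k x) := by
  induction x using TensorProduct.induction_on with
  | zero => simp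
  | add x y hx hy => rw [map_add, map_add, AddMonoidAlgebra.mapDomain_add, hx, hy]
  | tmul x y =>
    induction x using AddMonoidAlgebra.induction_linear with
    | zero => simp
    | add x x' hx hx' =>
      rw [TensorProduct.add_tmul, map_add, map_add, AddMonoidAlgebra.mapDomain_add, hx, hx']
    | single m a =>
      induction y using AddMonoidAlgebra.induction_linear with
      | zero => simp
      | add y y' hy hy' =>
        rw [TensorProduct.tmul_add, map_add, map_add, AddMonoidAlgebra.mapDomain_add, hy, hy']
      | single n c =>
        rw [squareChart_single, AddMonoidAlgebra.tensorEquiv_single_tmul_single,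
          AddMonoidAlgebra.mapDomain_single]
        rfl

lemma squareChart_injective (σ τ : PointedCone ℝ (RealSpace N)) :
    Function.Injective (squareChart k σ τ) := by
  intro x y h
  rw [squareChart_eq, squareChart_eq] at h
  exact (AddMonoidAlgebra.tensorEquiv k).injective (AddMonoidAlgebra.mapDomain_injective
    (Function.Injective.prodMap Subtype.val_injective Subtype.val_injective) h)

lemma mem_range_squareChart {σ τ : PointedCone ℝ (RealSpace N)} {x : TorusRing k N} :
    x ∈ (squareChart k σ τ).range ↔
      ∀ p, x.coeff p ≠ 0 → p.1 ∈ dualMonoid σ ∧ p.2 ∈ dualMonoid τ := by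
  classical
  constructor
  · rintro ⟨y, rfl⟩ p hp
    change (squareChart k σ τ y).coeff p ≠ 0 at hp
    rw [squareChart_eq, AddMonoidAlgebra.coeff_mapDomain] at hp
    obtain ⟨z, -, rfl⟩ := Finset.mem_image.1
      (Finsupp.mapDomain_support (Finsupp.mem_support_iff.2 hp))
    exact ⟨z.1.2, z.2.2⟩
  · intro h
    have hx : x = ∑ p ∈ x.coeff.support, AddMonoidAlgebra.single p (x.coeff p) := by
      ext p
      simp [AddMonoidAlgebra.coeff_sum, Finsupp.finsetSum_apply, Finsupp.single_apply]
    rw [hx]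
    refine Subalgebra.sum_mem _ fun p hp => ?_
    obtain ⟨h1, h2⟩ := h p (Finsupp.mem_support_iff.1 hp)
    refine ⟨AddMonoidAlgebra.single ⟨p.1, h1⟩ 1 ⊗ₜ
      AddMonoidAlgebra.single ⟨p.2, h2⟩ (x.coeff p), ?_⟩
    exact (squareChart_single _ _ _ _).trans (by rw [one_mul])

lemma squareChart_comp_map {σ τ σ' τ' : PointedCone ℝ (RealSpace N)} (h : σ' ≤ σ) (h' : τ' ≤ τ)
    (x : ChartRing k σ ⊗[k] ChartRing k τ) :
    squareChart k σ' τ' (Algebra.TensorProduct.map (chartMap k h) (chartMap k h') x) =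
      squareChart k σ τ x := by
  suffices (squareChart k σ' τ').comp (Algebra.TensorProduct.map (chartMap k h) (chartMap k h')) =
      squareChart k σ τ from DFunLike.congr_fun this x
  refine squareChart_hom_ext fun m n => ?_
  simp only [AlgHom.comp_apply, Algebra.TensorProduct.map_tmul, chartMap_single,
    squareChart_single, AddSubmonoid.coe_inclusion]

variable (k N)

/-- The endomorphism `x^m ↦ x^{qm}` of `k[M × M]`. -/
noncomputable def torusFrobenius (q : ℕ) : TorusRing k N →ₐ[k] TorusRing k N :=
  AddMonoidAlgebra.mapDomainAlgHom k k (nsmulAddMonoidHom q)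

/-- The restriction of functions on the square of the torus to the diagonal. -/
noncomputable def torusDiagonal : TorusRing k N →ₐ[k] AddMonoidAlgebra k (Module.Dual ℤ N) :=
  AddMonoidAlgebra.mapDomainAlgHom k k (AddMonoidHom.fst _ _ + AddMonoidHom.snd _ _)

variable {k N}

lemma torusFrobenius_single (q : ℕ) (p : Module.Dual ℤ N × Module.Dual ℤ N) (c : k) :
    torusFrobenius k N q (AddMonoidAlgebra.single p c) = AddMonoidAlgebra.single (q • p) c := by
  simp [torusFrobenius]

lemma torusDiagonal_single (p : Module.Dual ℤ N × Module.Dual ℤ N) (c : k) :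
    torusDiagonal k N (AddMonoidAlgebra.single p c) = AddMonoidAlgebra.single (p.1 + p.2) c := by
  simp [torusDiagonal]

lemma squareChart_chartFrobenius (q : ℕ) {σ τ : PointedCone ℝ (RealSpace N)}
    (x : ChartRing k σ ⊗[k] ChartRing k τ) :
    squareChart k σ τ (Algebra.TensorProduct.map (chartFrobenius k σ q) (chartFrobenius k τ q) x) =
      torusFrobenius k N q (squareChart k σ τ x) := by
  suffices (squareChart k σ τ).comp
      (Algebra.TensorProduct.map (chartFrobenius k σ q) (chartFrobenius k τ q)) =
      (torusFrobenius k N q).comp (squareChart k σ τ) from DFunLike.congr_fun this x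
  refine squareChart_hom_ext fun m n => ?_
  simp only [AlgHom.comp_apply, Algebra.TensorProduct.map_tmul, chartFrobenius_single,
    squareChart_single, torusFrobenius_single]
  rfl

lemma torusDiagonal_squareChart {σ : PointedCone ℝ (RealSpace N)}
    (x : ChartRing k σ ⊗[k] ChartRing k σ) :
    torusDiagonal k N (squareChart k σ σ x) =
      AddMonoidAlgebra.mapDomainAlgHom k k (dualMonoid σ).subtype
        (Algebra.TensorProduct.lmul' k x) := by
  suffices (torusDiagonal k N).comp (squareChart k σ σ) =
      (AddMonoidAlgebra.mapDomainAlgHom k k (dualMonoid σ).subtype).comp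
        (Algebra.TensorProduct.lmul' k) from DFunLike.congr_fun this x
  refine squareChart_hom_ext fun m n => ?_
  simp only [AlgHom.comp_apply, Algebra.TensorProduct.lmul'_apply_tmul, squareChart_single,
    torusDiagonal_single, AddMonoidAlgebra.single_mul_single]
  simp

lemma torusDiagonal_squareChart_eq_zero_iff {σ : PointedCone ℝ (RealSpace N)}
    (x : ChartRing k σ ⊗[k] ChartRing k σ) :
    torusDiagonal k N (squareChart k σ σ x) = 0 ↔ Algebra.TensorProduct.lmul' k x = 0 := by
  rw [torusDiagonal_squareChart]
  exact map_eq_zero_iff _ (AddMonoidAlgebra.mapDomain_injective Subtype.val_injective)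

lemma dual_smul_injective {q : ℕ} (hq : 0 < q) {m n : Module.Dual ℤ N} (h : q • m = q • n) :
    m = n := by
  ext x
  have := LinearMap.congr_fun h x
  simp only [LinearMap.smul_apply, nsmul_eq_mul] at this
  exact mul_left_cancel₀ (by exact_mod_cast hq.ne') this

instance dual_isAddTorsionFree : IsAddTorsionFree (Module.Dual ℤ N) :=
  ⟨fun _ hn _ _ h => dual_smul_injective (Nat.pos_of_ne_zero hn) h⟩

lemma torusFrobenius_injective {q : ℕ} (hq : 0 < q) :
    Function.Injective (torusFrobenius k N q) :=
  AddMonoidAlgebra.mapDomain_injective fun _ _ h =>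
    Prod.ext (dual_smul_injective hq (congrArg Prod.fst h))
      (dual_smul_injective hq (congrArg Prod.snd h))

instance torusRing_isDomain [Module.Free ℤ N] [Module.Finite ℤ N] : IsDomain (TorusRing k N) := by
  have : AddMonoid.FG (Module.Dual ℤ N) :=
    AddGroup.fg_iff_addMonoid_fg.1 (Module.Finite.iff_addGroup_fg.1 inferInstance)
  infer_instance

/-- The `q`-th power of a monomial is, up to its coefficient, in the image; sums of integral
elements are integral. -/
lemma torusFrobenius_isIntegral {q : ℕ} (hq : 0 < q) :
    (torusFrobenius k N q).toRingHom.IsIntegral := by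
  intro x
  induction x using AddMonoidAlgebra.induction_linear with
  | zero => exact RingHom.isIntegralElem_zero _
  | add x y hx hy => exact hx.add _ hy
  | single p c =>
    let _ := (torusFrobenius k N q).toRingHom.toAlgebra
    refine IsIntegral.of_pow (R := TorusRing k N) hq ?_
    rw [AddMonoidAlgebra.single_pow, ← torusFrobenius_single]
    exact isIntegral_algebraMap (R := TorusRing k N)

/-- A nonzero element integral over the image has a nonzero multiple there. Thus every fraction can
be given a denominator of the form `F y`, as needed to extend a semilinear map to the function
field. -/
lemma exists_mul_eq_torusFrobenius [Module.Free ℤ N] [Module.Finite ℤ N] {q : ℕ} (hq : 0 < q)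
    {x : TorusRing k N} (hx : x ≠ 0) : ∃ y ≠ 0, ∃ z, x * z = torusFrobenius k N q y := by
  let _ := (torusFrobenius k N q).toRingHom.toAlgebra
  have hint : IsIntegral (TorusRing k N) x := torusFrobenius_isIntegral hq x
  obtain ⟨y, hy, z, hz⟩ := hint.isAlgebraic.exists_nonzero_dvd (mem_nonZeroDivisors_of_ne_zero hx)
  exact ⟨y, hy, z, hz.symm⟩

/-! ### The splitting of the torus -/

/-- The additive map `x^{(m₁, m₂)} ↦ x^{(d m₁, s - d m₁)}` if `m₁ + m₂ = q s`, and
`x^{(m₁, m₂)} ↦ 0` if `m₁ + m₂` is not divisible by `q`. -/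
noncomputable def torusSplitting (k : Type u) [Field k] (q : ℕ)
    (d : Module.Dual ℤ N → Module.Dual ℤ N) : TorusRing k N →ₗ[k] TorusRing k N :=
  open Classical in
  Finsupp.linearCombination k (fun p : Module.Dual ℤ N × Module.Dual ℤ N =>
    if h : ∃ s, p.1 + p.2 = q • s then
      (AddMonoidAlgebra.single (d p.1, h.choose - d p.1) 1 : TorusRing k N) else 0) ∘ₗ
    (AddMonoidAlgebra.coeffLinearEquiv k).toLinearMap

lemma torusSplitting_single {q : ℕ} (hq : 0 < q) (d : Module.Dual ℤ N → Module.Dual ℤ N)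
    {m n s : Module.Dual ℤ N} (h : m + n = q • s) (c : k) :
    torusSplitting k q d (AddMonoidAlgebra.single (m, n) c) =
      AddMonoidAlgebra.single (d m, s - d m) c := by
  have hex : ∃ s, m + n = q • s := ⟨s, h⟩
  have hs : hex.choose = s := dual_smul_injective hq (hex.choose_spec.symm.trans h)
  simp [torusSplitting, hex, hs]

lemma torusSplitting_single_of_not {q : ℕ} (d : Module.Dual ℤ N → Module.Dual ℤ N)
    {m n : Module.Dual ℤ N} (h : ¬ ∃ s, m + n = q • s) (c : k) :
    torusSplitting k q d (AddMonoidAlgebra.single (m, n) c) = 0 := by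
  simp only [torusSplitting, LinearMap.comp_apply, LinearEquiv.coe_coe,
    AddMonoidAlgebra.coeffLinearEquiv_apply, AddMonoidAlgebra.coeff_single,
    Finsupp.linearCombination_single, dif_neg h, smul_zero]

lemma torusSplitting_mul {q : ℕ} (hq : 0 < q) {d : Module.Dual ℤ N → Module.Dual ℤ N}
    (hd : ∀ m n, d (m + q • n) = d m + n) (x y : TorusRing k N) :
    torusSplitting k q d (torusFrobenius k N q x * y) = x * torusSplitting k q d y := by
  induction x using AddMonoidAlgebra.induction_linear with
  | zero => simp
  | add x x' hx hx' => rw [map_add, add_mul, map_add, hx, hx', add_mul]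
  | single p c =>
    induction y using AddMonoidAlgebra.induction_linear with
    | zero => simp
    | add y y' hy hy' => rw [mul_add, map_add, map_add, mul_add, hy, hy']
    | single r e =>
      obtain ⟨p₁, p₂⟩ := p
      obtain ⟨m, n⟩ := r
      rw [torusFrobenius_single, AddMonoidAlgebra.single_mul_single, Prod.smul_mk, Prod.mk_add_mk]
      by_cases h : ∃ s, m + n = q • s
      · obtain ⟨s, hs⟩ := h
        have hs' : (q • p₁ + m) + (q • p₂ + n) = q • (s + p₁ + p₂) := by
          rw [smul_add, smul_add, ← hs]; abel
        rw [torusSplitting_single hq d hs, torusSplitting_single hq d hs',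
          AddMonoidAlgebra.single_mul_single, Prod.mk_add_mk, add_comm (q • p₁) m, hd]
        congr 2
        · abel
        · abel
      · rw [torusSplitting_single_of_not d h, torusSplitting_single_of_not d, mul_zero]
        rintro ⟨s, hs⟩
        refine h ⟨s - p₁ - p₂, ?_⟩
        rw [smul_sub, smul_sub, ← hs]; abel

lemma torusSplitting_one {q : ℕ} (hq : 0 < q) {d : Module.Dual ℤ N → Module.Dual ℤ N}
    (hd : d 0 = 0) : torusSplitting k q d 1 = 1 := by
  rw [AddMonoidAlgebra.one_def, ← Prod.mk_zero_zero, torusSplitting_single hq d (s := 0) (by simp),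
    hd, sub_zero]

/-- On the diagonal the choice of `d` cancels, because the two exponents of the image add up to `s`.
What is left is the standard map `x^{qs} ↦ x^s` on the torus, so functions vanishing on the diagonal
are preserved. -/
lemma coeff_torusDiagonal_torusSplitting {q : ℕ} (hq : 0 < q)
    (d : Module.Dual ℤ N → Module.Dual ℤ N) (x : TorusRing k N) (s : Module.Dual ℤ N) :
    (torusDiagonal k N (torusSplitting k q d x)).coeff s =
      (torusDiagonal k N x).coeff (q • s) := by
  classical
  induction x using AddMonoidAlgebra.induction_linear with
  | zero => simp
  | add x y hx hy => simp only [map_add, AddMonoidAlgebra.coeff_add, Finsupp.add_apply, hx, hy]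
  | single p c =>
    obtain ⟨m, n⟩ := p
    by_cases h : ∃ s, m + n = q • s
    · obtain ⟨s', hs'⟩ := h
      rw [torusSplitting_single hq d hs', torusDiagonal_single, torusDiagonal_single]
      simp only [AddMonoidAlgebra.coeff_single, hs', Finsupp.single_apply]
      refine if_congr ⟨fun h => ?_, fun h => ?_⟩ rfl rfl
      · rw [← h]; simp
      · rw [← dual_smul_injective hq h]; simp
    · rw [torusSplitting_single_of_not d h, torusDiagonal_single, map_zero]
      rw [AddMonoidAlgebra.coeff_single, Finsupp.single_apply, if_neg fun h' => h ⟨s, h'⟩]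
      simp

/-- If `m v ≥ 0`, then `q d(m) v > -q`, so `d(m) v ≥ 0` by integrality. The other half of the
absolute value bound does the same for `s - d(m)`. -/
lemma torusSplitting_mem_range {q : ℕ} (hq : 0 < q) {d : Module.Dual ℤ N → Module.Dual ℤ N}
    {V : Set N} (hd : ∀ m, ∀ v ∈ V, |m v - q * d m v| < q)
    {σ τ : PointedCone ℝ (RealSpace N)} {A B : Set N} (hA : A ⊆ V) (hB : B ⊆ V)
    (hσ : ∀ m : Module.Dual ℤ N, m ∈ dualMonoid σ ↔ ∀ v ∈ A, 0 ≤ m v)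
    (hτ : ∀ m : Module.Dual ℤ N, m ∈ dualMonoid τ ↔ ∀ v ∈ B, 0 ≤ m v)
    {x : TorusRing k N} (hx : x ∈ (squareChart k σ τ).range) :
    torusSplitting k q d x ∈ (squareChart k σ τ).range := by
  obtain ⟨y, rfl⟩ := hx
  change torusSplitting k q d (squareChart k σ τ y) ∈ _
  have hq' : (0 : ℤ) < q := by exact_mod_cast hq
  induction y using TensorProduct.induction_on with
  | zero => simp
  | add y y' hy hy' => rw [map_add, map_add]; exact add_mem hy hy'
  | tmul a c =>
    induction a using AddMonoidAlgebra.induction_linear with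
    | zero => simp
    | add a a' ha ha' => rw [TensorProduct.add_tmul, map_add, map_add]; exact add_mem ha ha'
    | single m r =>
      induction c using AddMonoidAlgebra.induction_linear with
      | zero => simp
      | add c c' hc hc' => rw [TensorProduct.tmul_add, map_add, map_add]; exact add_mem hc hc'
      | single n r' =>
        rw [squareChart_single]
        by_cases h : ∃ s, m.1 + n.1 = q • s
        · obtain ⟨s, hs⟩ := h
          have h1 : d m.1 ∈ dualMonoid σ := by
            rw [hσ]
            intro v hv
            have h1 := (hσ _).1 m.2 v hv
            have h2 := (abs_lt.1 (hd m.1 v (hA hv))).2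
            by_contra! h3
            nlinarith
          have h2 : s - d m.1 ∈ dualMonoid τ := by
            rw [hτ]
            intro v hv
            have h1 := (hτ _).1 n.2 v hv
            have h2 := (abs_lt.1 (hd m.1 v (hB hv))).1
            have h3 := LinearMap.congr_fun hs v
            simp only [LinearMap.add_apply, LinearMap.smul_apply, nsmul_eq_mul] at h3
            rw [LinearMap.sub_apply]
            by_contra! h4
            nlinarith
          rw [torusSplitting_single hq d hs]
          exact ⟨AddMonoidAlgebra.single ⟨_, h1⟩ 1 ⊗ₜ AddMonoidAlgebra.single ⟨_, h2⟩ (r * r'),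
            (squareChart_single _ _ _ _).trans (by rw [one_mul])⟩
        · rw [torusSplitting_single_of_not d h]
          exact zero_mem _

/-- Small representatives of the residue classes modulo `q` can be chosen periodically. -/
lemma HasSmallResidues.exists_quotient {V : Set N} {q : ℕ} (hq : 0 < q)
    (h : HasSmallResidues V q) : ∃ d : Module.Dual ℤ N → Module.Dual ℤ N,
      (∀ m n, d (m + q • n) = d m + n) ∧ d 0 = 0 ∧ ∀ m, ∀ v ∈ V, |m v - q * d m v| < q := by
  classical
  let H : AddSubgroup (Module.Dual ℤ N) := (nsmulAddMonoidHom q).range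
  have hH : ∀ m, ∃ n, m = q • n + (QuotientAddGroup.mk m : _ ⧸ H).out := by
    intro m
    have h1 : (QuotientAddGroup.mk (QuotientAddGroup.mk m : _ ⧸ H).out : _ ⧸ H) =
        QuotientAddGroup.mk m := Quotient.out_eq _
    obtain ⟨n, hn⟩ := QuotientAddGroup.eq.1 h1
    refine ⟨n, ?_⟩
    change q • n = _ at hn
    rw [hn]
    abel
  choose t ht using hH
  choose e he using h
  -- The zero class gets the representative `0`, and `small` below sends `0` to `0`. This
  -- normalization gives `d 0 = 0`, which makes the torus map fix `1`.
  let x : (_ ⧸ H) → Module.Dual ℤ N := fun c => if c = 0 then 0 else c.out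
  have hx : ∀ m, ∃ n, m = q • n + x (QuotientAddGroup.mk m) := by
    intro m
    by_cases h0 : (QuotientAddGroup.mk m : _ ⧸ H) = 0
    · obtain ⟨n, hn⟩ := (QuotientAddGroup.eq_zero_iff m).1 h0
      exact ⟨n, by simp only [x, if_pos h0, add_zero]; exact hn.symm⟩
    · exact ⟨t m, by simp only [x, if_neg h0]; exact ht m⟩
  choose t' ht' using hx
  let small : Module.Dual ℤ N → Module.Dual ℤ N := fun m => if m = 0 then 0 else e m
  have hsmall : ∀ m, ∀ v ∈ V, |m v - q * small m v| < q := by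
    intro m v hv
    by_cases h0 : m = 0
    · simp [small, h0, hq]
    · simpa only [small, if_neg h0] using he m v hv
  refine ⟨fun m => t' m + small (x (QuotientAddGroup.mk m)), fun m n => ?_, ?_, fun m v hv => ?_⟩
  · have h1 : (QuotientAddGroup.mk (m + q • n) : _ ⧸ H) = QuotientAddGroup.mk m := by
      rw [eq_comm, QuotientAddGroup.eq]
      exact ⟨n, by simp⟩
    have h2 := ht' (m + q • n)
    have h3 := ht' m
    rw [h1] at h2
    have h4 : t' (m + q • n) = t' m + n := by
      refine dual_smul_injective hq (add_right_cancel (b := x (QuotientAddGroup.mk m)) ?_)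
      rw [← h2, smul_add, add_right_comm, ← h3]
    simp only [h1, h4]
    abel
  · have h0 : x (QuotientAddGroup.mk 0) = 0 := if_pos rfl
    have h1 := ht' 0
    rw [h0, add_zero] at h1
    have h2 : t' 0 = 0 := dual_smul_injective hq (by rw [← h1, smul_zero])
    simp only [h0, h2, small, if_pos, add_zero]
  · have h1 := hsmall (x (QuotientAddGroup.mk m)) v hv
    have h2 := LinearMap.congr_fun (ht' m) v
    simp only [LinearMap.add_apply, LinearMap.smul_apply, nsmul_eq_mul] at h2 ⊢
    convert h1 using 2
    linear_combination h2

/-- A splitting of the torus that extends to the charts of the rays and is compatible with the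
diagonal provides small representatives of the residue classes modulo `q`. -/
lemma hasSmallResidues_of_splitting {V : Set N} (b : Module.Basis (Fin 2) ℤ N) {q : ℕ} (hq : 0 < q)
    (hV : ∀ v ∈ V, IsPrimitive v) (π : TorusRing k N →+ TorusRing k N) (h1 : π 1 = 1)
    (hmul : ∀ x y, π (torusFrobenius k N q x * y) = x * π y)
    (hfst : ∀ v ∈ V, ∀ x ∈ (squareChart k (latticeCone {v}) ⊥).range,
      π x ∈ (squareChart k (latticeCone {v}) ⊥).range)
    (hsnd : ∀ v ∈ V, ∀ x ∈ (squareChart k ⊥ (latticeCone {v})).range,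
      π x ∈ (squareChart k ⊥ (latticeCone {v})).range)
    (hdiag : ∀ x, torusDiagonal k N x = 0 → torusDiagonal k N (π x) = 0) :
    HasSmallResidues V q := by
  classical
  intro m
  have hq' : (0 : ℤ) < q := by exact_mod_cast hq
  set g := π (AddMonoidAlgebra.single (m, -m) 1) with hg
  have hg1 : torusDiagonal k N g = 1 := by
    -- The monomial `x^{(m, -m)}` equals `1` on the diagonal, and this survives applying `π`.
    have h2 := hdiag (AddMonoidAlgebra.single (m, -m) 1 - 1) (by
      rw [map_sub, torusDiagonal_single, map_one, AddMonoidAlgebra.one_def]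
      simp)
    rw [map_sub, map_sub, h1, map_one, sub_eq_zero] at h2
    exact h2
  obtain ⟨p, hp, hp0⟩ : ∃ p, g.coeff p ≠ 0 ∧ p.1 + p.2 = 0 := by
    have h2 : (torusDiagonal k N g).coeff 0 ≠ 0 := by
      rw [hg1, AddMonoidAlgebra.one_def, AddMonoidAlgebra.coeff_single, Finsupp.single_eq_same]
      exact one_ne_zero
    have h3 : (torusDiagonal k N g).coeff = Finsupp.mapDomain (fun p => p.1 + p.2) g.coeff := by
      change (AddMonoidAlgebra.mapDomain _ g).coeff = _
      rw [AddMonoidAlgebra.coeff_mapDomain]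
      rfl
    rw [h3] at h2
    obtain ⟨p, hp, hp0⟩ := Finset.mem_image.1
      (Finsupp.mapDomain_support (Finsupp.mem_support_iff.2 h2))
    exact ⟨p, Finsupp.mem_support_iff.1 hp, hp0⟩
  have hp2 : p.2 = -p.1 := by rw [eq_neg_iff_add_eq_zero, add_comm]; exact hp0
  have hbot : ∀ m : Module.Dual ℤ N, m ∈ dualMonoid (⊥ : PointedCone ℝ (RealSpace N)) := by
    intro m x hx
    rw [(Submodule.mem_bot _).1 hx, map_zero]
  have hcoeff : ∀ r : Module.Dual ℤ N × Module.Dual ℤ N,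
      (π (AddMonoidAlgebra.single (q • r + (m, -m)) 1)).coeff (r + p) ≠ 0 := by
    intro r
    have h2 := hmul (AddMonoidAlgebra.single r 1) (AddMonoidAlgebra.single (m, -m) 1)
    rw [torusFrobenius_single, AddMonoidAlgebra.single_mul_single, one_mul] at h2
    rw [h2, ← hg, AddMonoidAlgebra.coeff_single_mul_add, one_mul]
    exact hp
  -- The exponent `p = (e, -e)` found in `g` supplies the representative `m - q e`.
  refine ⟨p.1, fun v hv => ?_⟩
  obtain ⟨w, hw⟩ := (hV v hv).exists_area_eq_one b
  obtain ⟨n, hn⟩ : ∃ n : Module.Dual ℤ N, n v = 1 := ⟨-area b w, by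
    rw [LinearMap.neg_apply, ← area_swap, hw]⟩
  have hmod := Int.emod_nonneg (m v) hq'.ne'
  have hmod' := Int.emod_nonneg (-m v) hq'.ne'
  rw [Int.emod_def] at hmod hmod'
  rw [abs_lt]
  constructor
  -- The shift by a multiple of `q` brings the value of the second exponent at `v` into `[0, q)`.
  -- The monomial is then regular along the ray, and so is its image; the floor gives the sharp
  -- inequality. The other bound uses the first factor.
  · have h2 := hsnd v hv (AddMonoidAlgebra.single (q • (0, (-(-m v / q)) • n) + (m, -m)) 1)
      (mem_range_squareChart.2 fun r hr => ?_)
    · have h3 := (mem_range_squareChart.1 h2 _ (hcoeff _)).2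
      rw [mem_dualMonoid_latticeCone] at h3
      have h4 := h3 v rfl
      simp only [Prod.snd_add, hp2, LinearMap.add_apply, LinearMap.smul_apply, smul_eq_mul, hn,
        LinearMap.neg_apply] at h4
      have h5 := Int.emod_lt_of_pos (-m v) hq'
      rw [Int.emod_def] at h5
      nlinarith
    · rw [AddMonoidAlgebra.coeff_single, Finsupp.single_apply_ne_zero] at hr
      rw [hr.1, mem_dualMonoid_latticeCone]
      refine ⟨hbot _, ?_⟩
      rintro _ rfl
      simp only [Prod.snd_add, Prod.smul_snd, LinearMap.add_apply, LinearMap.smul_apply,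
        nsmul_eq_mul, smul_eq_mul, hn, LinearMap.neg_apply]
      linarith
  · have h2 := hfst v hv (AddMonoidAlgebra.single (q • ((-(m v / q)) • n, 0) + (m, -m)) 1)
      (mem_range_squareChart.2 fun r hr => ?_)
    · have h3 := (mem_range_squareChart.1 h2 _ (hcoeff _)).1
      rw [mem_dualMonoid_latticeCone] at h3
      have h4 := h3 v rfl
      simp only [Prod.fst_add, LinearMap.add_apply, LinearMap.smul_apply, smul_eq_mul, hn] at h4
      have h5 := Int.emod_lt_of_pos (m v) hq'
      rw [Int.emod_def] at h5
      nlinarith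
    · rw [AddMonoidAlgebra.coeff_single, Finsupp.single_apply_ne_zero] at hr
      rw [hr.1, mem_dualMonoid_latticeCone]
      refine ⟨?_, hbot _⟩
      rintro _ rfl
      simp only [Prod.fst_add, Prod.smul_fst, LinearMap.add_apply, LinearMap.smul_apply,
        nsmul_eq_mul, smul_eq_mul, hn]
      linarith

end TorusSquare

/-! ### Extension of semilinear maps to the fraction field -/

/-- An additive map on a domain that is semilinear for the inverse of an integral injective
endomorphism extends to the fraction field. -/
lemma exists_fractionField_extension {A K : Type*} [CommRing A] [IsDomain A] [Field K] [Algebra A K]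
    [IsFractionRing A K] (F : A →+* A) (FK : K →+* K)
    (hFK : ∀ a, FK (algebraMap A K a) = algebraMap A K (F a))
    (hint : ∀ x : A, x ≠ 0 → ∃ y ≠ 0, ∃ z, x * z = F y) (π : A →+ A)
    (hπ : ∀ x y, π (F x * y) = x * π y) :
    ∃ πK : K →+ K, (∀ x y, πK (FK x * y) = x * πK y) ∧
      ∀ a, πK (algebraMap A K a) = algebraMap A K (π a) := by
  have hF : ∀ x, x ≠ 0 → F x ≠ 0 := by
    intro x hx h
    have h1 : FK (algebraMap A K x) = 0 := by rw [hFK, h, map_zero]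
    rw [map_eq_zero, map_eq_zero_iff _ (IsFractionRing.injective A K)] at h1
    exact hx h1
  have hinj := IsFractionRing.injective A K
  have hne : ∀ {a : A}, a ≠ 0 → algebraMap A K a ≠ 0 := fun ha =>
    (map_ne_zero_iff _ hinj).2 ha
  -- Every `z` is `x / F y`, so semilinearity dictates the value `π x / y`. The lemma `key` shows
  -- that it does not depend on the chosen fraction.
  have hex : ∀ z : K, ∃ y x : A, y ≠ 0 ∧ z * algebraMap A K (F y) = algebraMap A K x := by
    intro z
    obtain ⟨a, c, hc, rfl⟩ := IsFractionRing.div_surjective (A := A) z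
    obtain ⟨y, hy, w, hw⟩ := hint c (nonZeroDivisors.ne_zero hc)
    refine ⟨y, a * w, hy, ?_⟩
    rw [← hw, map_mul, map_mul]
    field_simp [hne (nonZeroDivisors.ne_zero hc)]
  choose y x hy hyx using hex
  have key : ∀ (z : K) (y' x' : A), z * algebraMap A K (F y') = algebraMap A K x' →
      algebraMap A K (π (x z)) * algebraMap A K y' =
        algebraMap A K (π x') * algebraMap A K (y z) := by
    intro z y' x' h
    have h1 : F y' * x z = F (y z) * x' := by
      apply hinj
      rw [map_mul, map_mul, ← hyx, ← h]
      ring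
    have h2 := congrArg π h1
    rw [hπ, hπ] at h2
    rw [← map_mul, ← map_mul, mul_comm, h2, mul_comm]
  have val : ∀ (z : K) (y' x' : A), y' ≠ 0 → z * algebraMap A K (F y') = algebraMap A K x' →
      algebraMap A K (π (x z)) / algebraMap A K (y z) =
        algebraMap A K (π x') / algebraMap A K y' := by
    intro z y' x' hy' h
    rw [div_eq_div_iff (hne (hy z)) (hne hy')]
    exact key z y' x' h
  refine ⟨AddMonoidHom.mk' (fun z => algebraMap A K (π (x z)) / algebraMap A K (y z)) ?_, ?_, ?_⟩
  · intro z z'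
    rw [val (z + z') (y z * y z') (F (y z') * x z + F (y z) * x z')
      (mul_ne_zero (hy z) (hy z')), map_add, hπ, hπ]
    · have := hne (hy z)
      have := hne (hy z')
      simp only [map_add, map_mul]
      field_simp
    · simp only [map_add, map_mul, ← hyx]
      ring
  · intro a z
    change algebraMap A K _ / _ = a * (algebraMap A K _ / _)
    obtain ⟨c, e, he, rfl⟩ := IsFractionRing.div_surjective (A := A) a
    have he0 := nonZeroDivisors.ne_zero he
    rw [val _ (e * y z) (F c * x z) (mul_ne_zero he0 (hy z)), hπ]
    · simp only [map_mul]
      have := hne he0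
      have := hne (hy z)
      field_simp
    · rw [map_div₀, hFK, hFK]
      simp only [map_mul, ← hyx]
      have := hne (hF e he0)
      field_simp
  · intro a
    change algebraMap A K _ / _ = _
    rw [val _ 1 a one_ne_zero (by simp)]
    simp

/-! ### Sections over basic open subsets of affine charts -/

section SpecSections

open TopologicalSpace

/-- The restriction of an element of `R` to an open subset of `Spec R`. -/
noncomputable def specRes (R : CommRingCat.{u}) (U : (Spec R).Opens) : R ⟶ Γ(Spec R, U) :=
  (Scheme.ΓSpecIso R).inv ≫ (Spec R).presheaf.map (homOfLE le_top).op

/-- The basic open subset of `Spec R` on which `f` does not vanish. -/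
abbrev basicOpens {R : CommRingCat.{u}} (f : R) : (Spec R).Opens := PrimeSpectrum.basicOpen f

lemma isLocalization_basicOpens {R : CommRingCat.{u}} (f : R) :
    letI := ((Spec R).presheaf.map (homOfLE le_top : basicOpens f ⟶ ⊤).op).hom.toAlgebra
    IsLocalization.Away ((Scheme.ΓSpecIso R).inv f) Γ(Spec R, basicOpens f) :=
  (isAffineOpen_top (Spec R)).isLocalization_of_eq_basicOpen _ _ (basicOpen_eq_of_affine f).symm

lemma isUnit_specRes {R : CommRingCat.{u}} (f : R) : IsUnit (specRes R (basicOpens f) f) := by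
  let _ := ((Spec R).presheaf.map (homOfLE le_top : basicOpens f ⟶ ⊤).op).hom.toAlgebra
  have := isLocalization_basicOpens f
  exact IsLocalization.Away.algebraMap_isUnit (S := Γ(Spec R, basicOpens f))
    ((Scheme.ΓSpecIso R).inv f)

lemma exists_specRes_eq {R : CommRingCat.{u}} (f : R) (s : Γ(Spec R, basicOpens f)) :
    ∃ (n : ℕ) (c : R), s * specRes R _ f ^ n = specRes R _ c := by
  let _ := ((Spec R).presheaf.map (homOfLE le_top : basicOpens f ⟶ ⊤).op).hom.toAlgebra
  have := isLocalization_basicOpens f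
  obtain ⟨n, c, h⟩ := IsLocalization.Away.surj ((Scheme.ΓSpecIso R).inv f) s
  refine ⟨n, (Scheme.ΓSpecIso R).hom c, h.trans ?_⟩
  have h1 : (Scheme.ΓSpecIso R).inv ((Scheme.ΓSpecIso R).hom c) = c :=
    congrArg (fun ψ => ψ.hom c) (Scheme.ΓSpecIso R).hom_inv_id
  exact congrArg ((Spec R).presheaf.map (homOfLE le_top : basicOpens f ⟶ ⊤).op) h1.symm

lemma exists_pow_mul_eq_zero {R : CommRingCat.{u}} (f : R) {c : R}
    (h : specRes R (basicOpens f) c = 0) : ∃ n : ℕ, f ^ n * c = 0 := by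
  let _ := ((Spec R).presheaf.map (homOfLE le_top : basicOpens f ⟶ ⊤).op).hom.toAlgebra
  have := isLocalization_basicOpens f
  obtain ⟨⟨_, n, rfl⟩, hn⟩ := (IsLocalization.map_eq_zero_iff
    (Submonoid.powers ((Scheme.ΓSpecIso R).inv f)) Γ(Spec R, basicOpens f)
    ((Scheme.ΓSpecIso R).inv c)).1 h
  refine ⟨n, (ConcreteCategory.bijective_of_isIso (Scheme.ΓSpecIso R).inv).1 ?_⟩
  rw [map_mul, map_pow, map_zero]
  exact hn

lemma specRes_appLE {R S : CommRingCat.{u}} (φ : R ⟶ S) (U : (Spec R).Opens) (V : (Spec S).Opens)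
    (h : V ≤ Spec.map φ ⁻¹ᵁ U) : specRes R U ≫ (Spec.map φ).appLE U V h = φ ≫ specRes S V := by
  rw [specRes, specRes, Category.assoc, Scheme.Hom.map_appLE, Scheme.ΓSpecIso_inv_naturality_assoc,
    Scheme.Hom.appLE]
  rfl

lemma specRes_appLE_apply {R S : CommRingCat.{u}} (φ : R ⟶ S) (U : (Spec R).Opens)
    (V : (Spec S).Opens) (h : V ≤ Spec.map φ ⁻¹ᵁ U) (x : R) :
    (Spec.map φ).appLE U V h (specRes R U x) = specRes S V (φ x) :=
  congrArg (fun ψ => ψ.hom x) (specRes_appLE φ U V h)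

lemma specRes_top_hom (R : CommRingCat.{u}) : specRes R ⊤ ≫ (Scheme.ΓSpecIso R).hom = 𝟙 R := by
  rw [specRes]
  simp

lemma le_preimage_basicOpens {R S : CommRingCat.{u}} (φ : R ⟶ S) {f : R} :
    basicOpens (φ f) ≤ Spec.map φ ⁻¹ᵁ basicOpens f :=
  fun _ hx => hx

lemma mem_basicOpens_map {R S : CommRingCat.{u}} (φ : R ⟶ S) {f : R} {x : Spec S} :
    x ∈ basicOpens (φ f) ↔ Spec.map φ x ∈ basicOpens f := Iff.rfl

lemma exists_basicOpens {R : CommRingCat.{u}} {U : (Spec R).Opens} {x : Spec R} (hx : x ∈ U) :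
    ∃ f : R, x ∈ basicOpens f ∧ basicOpens f ≤ U := by
  obtain ⟨_, ⟨_, ⟨f, rfl⟩, rfl⟩, hxf, hf⟩ :=
    PrimeSpectrum.isBasis_basic_opens.exists_subset_of_mem_open hx U.isOpen
  exact ⟨f, hxf, hf⟩

lemma ne_zero_of_mem_basicOpens {R : CommRingCat.{u}} {f : R} {x : Spec R}
    (hx : x ∈ basicOpens f) : f ≠ 0 := by
  rintro rfl
  exact hx (zero_mem _)

/-- A section over the image of a basic open subset of a chart vanishes if it does so on the
chart. -/
lemma map_eq_zero_of_appLE_eq_zero {Y W : Scheme.{u}} (ι : W ⟶ Y) [IsOpenImmersion ι] {U : Y.Opens}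
    {V : W.Opens} (h : V ≤ ι ⁻¹ᵁ U) (hU : ι ''ᵁ V ≤ U) {s : Γ(Y, U)} (hs : ι.appLE U V h s = 0) :
    Y.presheaf.map (homOfLE hU).op s = 0 := by
  have h1 := congrArg (fun ψ => ψ.hom s) (ι.appLE_appIso_inv h)
  change (ι.appIso V).inv (ι.appLE U V h s) = Y.presheaf.map _ s at h1
  rw [hs, map_zero] at h1
  exact h1.symm

end SpecSections

lemma appLE_congr_hom {W Y : Scheme.{u}} {f f' : W ⟶ Y} (hf : f = f') {U : Y.Opens} {V : W.Opens}
    (h : V ≤ f ⁻¹ᵁ U) (h' : V ≤ f' ⁻¹ᵁ U) : f.appLE U V h = f'.appLE U V h' := by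
  subst hf
  rfl

/-! ### Evaluation at a point with values in a ring -/

section Eval

variable {Y : Scheme.{u}} {K : Type u} [CommRing K] (g : Spec (.of K) ⟶ Y)

/-- The value in `K` of a function at a `K`-valued point. -/
noncomputable def evalPoint (U : Y.Opens) (h : ⊤ ≤ g ⁻¹ᵁ U) : Γ(Y, U) →+* K :=
  (g.appLE U ⊤ h ≫ (Scheme.ΓSpecIso (.of K)).hom).hom

lemma evalPoint_map {U V : Y.Opens} (i : V ≤ U) (h : ⊤ ≤ g ⁻¹ᵁ V) (s : Γ(Y, U)) :
    evalPoint g V h (Y.presheaf.map (homOfLE i).op s) =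
      evalPoint g U (h.trans (g.preimage_mono i)) s := by
  have h1 := g.map_appLE h (homOfLE i).op
  exact congrArg (fun ψ => (Scheme.ΓSpecIso (.of K)).hom.hom (ψ.hom s)) h1

lemma evalPoint_congr {g g' : Spec (.of K) ⟶ Y} (hg : g = g') (U : Y.Opens) (h : ⊤ ≤ g ⁻¹ᵁ U)
    (h' : ⊤ ≤ g' ⁻¹ᵁ U) : evalPoint g U h = evalPoint g' U h' := by
  subst hg
  rfl

lemma evalPoint_specMap {L : Type u} [CommRing L] (r : K →+* L) (U : Y.Opens) (h : ⊤ ≤ g ⁻¹ᵁ U)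
    (h' : ⊤ ≤ (Spec.map (CommRingCat.ofHom r) ≫ g) ⁻¹ᵁ U) (s : Γ(Y, U)) :
    evalPoint (Spec.map (CommRingCat.ofHom r) ≫ g) U h' s = r (evalPoint g U h s) := by
  have h1 : (Spec.map (CommRingCat.ofHom r) ≫ g).appLE U ⊤ h' =
      g.appLE U ⊤ h ≫ (Spec.map (CommRingCat.ofHom r)).appTop := by
    refine
      (Scheme.Hom.appLE_comp_appLE (Spec.map (CommRingCat.ofHom r)) g U ⊤ ⊤ h le_rfl).symm.trans
      (congrArg (g.appLE U ⊤ h ≫ ·) ?_)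
    exact (Scheme.Hom.app_eq_appLE _).symm
  have h2 := Scheme.ΓSpecIso_naturality (CommRingCat.ofHom r)
  have h3 : (Spec.map (CommRingCat.ofHom r) ≫ g).appLE U ⊤ h' ≫ (Scheme.ΓSpecIso (.of L)).hom =
      (g.appLE U ⊤ h ≫ (Scheme.ΓSpecIso (.of K)).hom) ≫ CommRingCat.ofHom r := by
    rw [h1, Category.assoc, Category.assoc, h2]
  exact congrArg (fun ψ => ψ.hom s) h3

lemma evalPoint_comp {X : Scheme.{u}} (j : Y ⟶ X) (U : X.Opens) (h : ⊤ ≤ (g ≫ j) ⁻¹ᵁ U)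
    (h' : ⊤ ≤ g ⁻¹ᵁ (j ⁻¹ᵁ U)) (a : Γ(X, U)) :
    evalPoint (g ≫ j) U h a = evalPoint g (j ⁻¹ᵁ U) h' (j.app U a) :=
  congrArg (fun ψ => (Scheme.ΓSpecIso (.of K)).hom.hom (ψ.hom a))
    (Scheme.Hom.comp_appLE g j U ⊤ h')

lemma evalPoint_app {F : Y ⟶ Y} {φ : K →+* K} (hF : g ≫ F = Spec.map (CommRingCat.ofHom φ) ≫ g)
    (U : Y.Opens) (h : ⊤ ≤ g ⁻¹ᵁ U) (h' : ⊤ ≤ g ⁻¹ᵁ (F ⁻¹ᵁ U)) (a : Γ(Y, U)) :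
    evalPoint g (F ⁻¹ᵁ U) h' (F.app U a) = φ (evalPoint g U h a) := by
  rw [← evalPoint_comp g F U h', evalPoint_congr hF U h' (hF ▸ h'), evalPoint_specMap g φ U h]

lemma evalPoint_bijective [IsOpenImmersion g] {U : Y.Opens} (hU : U = g ''ᵁ ⊤) (h : ⊤ ≤ g ⁻¹ᵁ U) :
    Function.Bijective (evalPoint g U h) := by
  subst hU
  have h1 : g.appLE (g ''ᵁ ⊤) ⊤ h = (g.appIso ⊤).hom := (g.appIso_hom' ⊤).symm
  have h2 : IsIso (g.appLE (g ''ᵁ ⊤) ⊤ h ≫ (Scheme.ΓSpecIso (.of K)).hom) := by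
    rw [h1]
    infer_instance
  exact ConcreteCategory.bijective_of_isIso
    (g.appLE (g ''ᵁ ⊤) ⊤ h ≫ (Scheme.ΓSpecIso (.of K)).hom)

end Eval

section EvalField

variable {Y : Scheme.{u}} {K : Type u} [Field K] {g : Spec (.of K) ⟶ Y}
  {R : CommRingCat.{u}} {ι : Spec R ⟶ Y} {e : R ⟶ .of K}

lemma top_le_of_chart (hg : Spec.map e ≫ ι = g) {f : R} (hf : e f ≠ 0) {U : Y.Opens}
    (hU : basicOpens f ≤ ι ⁻¹ᵁ U) : ⊤ ≤ g ⁻¹ᵁ U := by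
  subst hg
  intro x _
  refine hU (mem_basicOpens_map e |>.1 ?_)
  intro hx
  exact x.2.ne_top (Ideal.eq_top_of_isUnit_mem _ hx (isUnit_iff_ne_zero.2 hf))

lemma evalPoint_mul_pow (hg : Spec.map e ≫ ι = g) {f : R} (hf : e f ≠ 0) {U : Y.Opens}
    (hU : basicOpens f ≤ ι ⁻¹ᵁ U) {s : Γ(Y, U)} {n : ℕ} {c : R}
    (h : ι.appLE U (basicOpens f) hU s * specRes R _ f ^ n = specRes R _ c) (hgU : ⊤ ≤ g ⁻¹ᵁ U) :
    evalPoint g U hgU s * e f ^ n = e c := by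
  subst hg
  have hle : (⊤ : (Spec (.of K)).Opens) ≤ Spec.map e ⁻¹ᵁ basicOpens f :=
    top_le_of_chart (ι := 𝟙 _) (Category.comp_id (Spec.map e)) hf le_rfl
  let χ : Γ(Spec R, basicOpens f) ⟶ .of K :=
    (Spec.map e).appLE (basicOpens f) ⊤ hle ≫ (Scheme.ΓSpecIso (.of K)).hom
  have h1 : specRes R (basicOpens f) ≫ χ = e := by
    have := specRes_top_hom (.of K)
    rw [← Category.assoc, specRes_appLE, Category.assoc, this, Category.comp_id]
  have h2 : ι.appLE U (basicOpens f) hU ≫ χ =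
      (Spec.map e ≫ ι).appLE U ⊤ hgU ≫ (Scheme.ΓSpecIso (.of K)).hom := by
    rw [← Category.assoc, Scheme.Hom.appLE_comp_appLE]
  have h3 := congrArg (fun x => χ x) h
  simp only [map_mul, map_pow] at h3
  have h4 : ∀ x, χ (specRes R (basicOpens f) x) = e x := fun x => congrArg (fun ψ => ψ.hom x) h1
  have h5 : χ (ι.appLE U (basicOpens f) hU s) = evalPoint (Spec.map e ≫ ι) U hgU s :=
    congrArg (fun ψ => ψ.hom s) h2
  rwa [h4, h4, h5] at h3

/-- A section over a basic open set is a fraction `c / f ^ n`. Its vanishing in `K` gives `c = 0`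
because the chart ring embeds in `K`. If `f = 0`, the section ring is trivial. -/
lemma appLE_eq_zero_of_evalPoint_eq_zero (hg : Spec.map e ≫ ι = g) (he : Function.Injective e)
    (f : R) {U : Y.Opens} (hU : basicOpens f ≤ ι ⁻¹ᵁ U) {s : Γ(Y, U)}
    (hs : ∀ h, evalPoint g U h s = 0) : ι.appLE U (basicOpens f) hU s = 0 := by
  have hunit := isUnit_specRes f
  by_cases hf : f = 0
  · have : Subsingleton Γ(Spec R, basicOpens f) := by
      refine subsingleton_of_zero_eq_one (isUnit_zero_iff.1 ?_)
      have h0 : specRes R (basicOpens f) f = 0 := by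
        rw [show f = 0 from hf, map_zero]
      rwa [h0] at hunit
    exact Subsingleton.elim _ _
  have hf' : e f ≠ 0 := (map_ne_zero_iff _ he).2 hf
  obtain ⟨n, c, hc⟩ := exists_specRes_eq f (ι.appLE U (basicOpens f) hU s)
  have h1 := evalPoint_mul_pow hg hf' hU hc (top_le_of_chart hg hf' hU)
  rw [hs, zero_mul] at h1
  rw [(map_eq_zero_iff _ he).1 h1.symm, map_zero] at hc
  exact (hunit.pow n).mul_left_eq_zero.1 hc

end EvalField

/-! ### Splittings from affine charts with a common generic point -/

/-- A system of affine charts that cover a scheme `Y`, are preserved by an endomorphism `F` and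
share a generic point `g` with values in a field `K`. -/
structure GenericCharts {Y : Scheme.{u}} (F : Y ⟶ Y) {K : Type u} [Field K]
    (g : Spec (.of K) ⟶ Y) (φ : K →+* K) where
  I : Type u
  R : I → CommRingCat.{u}
  ι (i : I) : Spec (R i) ⟶ Y
  isOpenImmersion (i : I) : IsOpenImmersion (ι i)
  exists_eq (y : Y) : ∃ i x, ι i x = y
  frob (i : I) : R i ⟶ R i
  ι_frob (i : I) : ι i ≫ F = Spec.map (frob i) ≫ ι i
  e (i : I) : R i ⟶ .of K
  e_injective (i : I) : Function.Injective (e i)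
  e_ι (i : I) : Spec.map (e i) ≫ ι i = g
  e_frob (i : I) (x : R i) : e i (frob i x) = φ (e i x)
  g_frob : g ≫ F = Spec.map (CommRingCat.ofHom φ) ≫ g

namespace GenericCharts

attribute [instance] isOpenImmersion

variable {Y : Scheme.{u}} {F : Y ⟶ Y} {K : Type u} [Field K] {g : Spec (.of K) ⟶ Y} {φ : K →+* K}
  (C : GenericCharts F g φ)

include C

lemma exists_basicOpens {U : Y.Opens} {y : Y} (hy : y ∈ U) :
    ∃ (i : C.I) (f : C.R i), C.e i f ≠ 0 ∧ y ∈ C.ι i ''ᵁ basicOpens f ∧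
      basicOpens f ≤ C.ι i ⁻¹ᵁ U := by
  obtain ⟨i, x, rfl⟩ := C.exists_eq y
  obtain ⟨f, hxf, hf⟩ := Toric.exists_basicOpens (U := C.ι i ⁻¹ᵁ U) hy
  exact ⟨i, f, (map_ne_zero_iff _ (C.e_injective i)).2 (ne_zero_of_mem_basicOpens hxf),
    ⟨x, hxf, rfl⟩, hf⟩

lemma top_le {U : Y.Opens} {y : Y} (hy : y ∈ U) : ⊤ ≤ g ⁻¹ᵁ U := by
  obtain ⟨i, f, hf, -, hfU⟩ := C.exists_basicOpens hy
  exact top_le_of_chart (C.e_ι i) hf hfU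

lemma top_le_frob {U : Y.Opens} (h : ⊤ ≤ g ⁻¹ᵁ U) : ⊤ ≤ g ⁻¹ᵁ (F ⁻¹ᵁ U) := by
  intro x hx
  change (g ≫ F) x ∈ U
  rw [C.g_frob]
  exact h (Set.mem_univ (Spec.map (CommRingCat.ofHom φ) x))

omit C in
lemma image_le {W : Scheme.{u}} (ι : W ⟶ Y) [IsOpenImmersion ι] {V : W.Opens} {U : Y.Opens}
    (h : V ≤ ι ⁻¹ᵁ U) : ι ''ᵁ V ≤ U := by
  rintro _ ⟨x, hx, rfl⟩
  exact h hx

/-- A function that vanishes at the generic point is zero. -/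
lemma eq_zero {U : Y.Opens} {s : Γ(Y, U)} (hs : ∀ h, evalPoint g U h s = 0) : s = 0 := by
  choose i f hf hy hfU using fun y : U => C.exists_basicOpens y.2
  refine Y.sheaf.eq_of_locally_eq' (fun y : U => C.ι (i y) ''ᵁ basicOpens (f y)) U
    (fun y => homOfLE (image_le _ (hfU y))) (fun y hy' => ?_) s 0 fun y => ?_
  · exact TopologicalSpace.Opens.mem_iSup.2 ⟨⟨y, hy'⟩, hy _⟩
  · have h1 := appLE_eq_zero_of_evalPoint_eq_zero (C.e_ι (i y)) (C.e_injective _) (f y) (hfU y) hs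
    have h2 := map_eq_zero_of_appLE_eq_zero _ (hfU y) (image_le _ (hfU y)) h1
    rw [map_zero]
    exact h2

lemma eq_of_evalPoint {U : Y.Opens} {s t : Γ(Y, U)}
    (hs : ∀ h, evalPoint g U h s = evalPoint g U h t) : s = t :=
  sub_eq_zero.1 (C.eq_zero fun h => by rw [map_sub, hs, sub_self])

omit C in
/-- A fraction is a function on a basic open subset of a chart. -/
lemma exists_section_of_fraction {R : CommRingCat.{u}} (ι : Spec R ⟶ Y) [IsOpenImmersion ι]
    {e : R ⟶ .of K} (hg : Spec.map e ≫ ι = g) {f c : R} (hf : e f ≠ 0) {n : ℕ} {z : K}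
    (hz : z * e f ^ n = e c) :
    ∃ s : Γ(Y, ι ''ᵁ basicOpens f), ∀ h, evalPoint g _ h s = z := by
  obtain ⟨u, hu⟩ := isUnit_specRes f
  let t : Γ(Spec R, basicOpens f) := specRes R (basicOpens f) c * ↑(u⁻¹ ^ n)
  have ht : t * specRes R _ f ^ n = specRes R _ c := by
    simp only [t, ← hu]
    rw [mul_assoc, ← Units.val_pow_eq_pow_val, ← Units.val_mul, ← mul_pow, inv_mul_cancel, one_pow,
      Units.val_one, mul_one]
  refine ⟨(ι.appIso (basicOpens f)).inv t, fun h => ?_⟩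
  have hle : basicOpens f ≤ ι ⁻¹ᵁ ι ''ᵁ basicOpens f := (Scheme.Hom.preimage_image_eq ι _).ge
  have h1 : ι.appLE (ι ''ᵁ basicOpens f) (basicOpens f) hle ((ι.appIso (basicOpens f)).inv t) =
      t := by
    rw [← Scheme.Hom.appIso_hom']
    exact congrArg (fun ψ => ψ.hom t) (ι.appIso (basicOpens f)).inv_hom_id
  have h2 := evalPoint_mul_pow hg hf hle (s := (ι.appIso (basicOpens f)).inv t) (n := n) (c := c)
    (by rw [h1, ht]) h
  exact mul_right_cancel₀ (pow_ne_zero n hf) (h2.trans hz.symm)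

/-- An element of `K` that is locally a fraction is a function. -/
lemma exists_section {U : Y.Opens} (z : K)
    (hz : ∀ (i : C.I) (f : C.R i), C.e i f ≠ 0 → basicOpens f ≤ C.ι i ⁻¹ᵁ U →
      ∃ (n : ℕ) (c : C.R i), z * C.e i f ^ n = C.e i c) :
    ∃ s : Γ(Y, U), ∀ h, evalPoint g U h s = z := by
  choose i f hf hy hfU using fun y : U => C.exists_basicOpens y.2
  choose n c hc using fun y => hz (i y) (f y) (hf y) (hfU y)
  choose s hs using fun y => exists_section_of_fraction (C.ι (i y)) (C.e_ι (i y)) (hf y) (hc y)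
  obtain ⟨t, ht, -⟩ := Y.sheaf.existsUnique_gluing'
    (fun y : U => C.ι (i y) ''ᵁ basicOpens (f y)) U
    (fun y => homOfLE (image_le _ (hfU y)))
    (fun y hy' => TopologicalSpace.Opens.mem_iSup.2 ⟨⟨y, hy'⟩, hy _⟩) s (by
      intro y y'
      -- Local sections agree on overlaps because all of them have the value `z` at the generic
      -- point.
      refine C.eq_of_evalPoint fun h => ?_
      refine (evalPoint_map g _ h (s y)).trans (Eq.trans ?_ (evalPoint_map g _ h (s y')).symm)
      rw [hs, hs])
  refine ⟨t, fun h => ?_⟩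
  let p : Spec (.of K) := default
  have hp : g p ∈ U := h (Set.mem_univ p)
  have h1 := ht ⟨g p, hp⟩
  have h2 := evalPoint_map g (image_le _ (hfU ⟨g p, hp⟩)) (C.top_le (hy ⟨g p, hp⟩)) t
  exact h2.symm.trans ((congrArg (evalPoint g _ (C.top_le (hy ⟨g p, hp⟩))) h1).trans (hs _ _))

variable {C} in
lemma le_preimage_frob {i : C.I} {f : C.R i} {U : Y.Opens} (hU : basicOpens f ≤ C.ι i ⁻¹ᵁ U) :
    basicOpens (C.frob i f) ≤ C.ι i ⁻¹ᵁ (F ⁻¹ᵁ U) := by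
  intro x hx
  change (C.ι i ≫ F) x ∈ U
  rw [C.ι_frob]
  exact hU (le_preimage_basicOpens (C.frob i) hx)

lemma e_frob_ne_zero {i : C.I} {f : C.R i} (hf : C.e i f ≠ 0) : C.e i (C.frob i f) ≠ 0 := by
  rw [C.e_frob]
  exact (map_ne_zero_iff _ φ.injective).2 hf

/-! ### From a splitting of the function field to a splitting of the scheme -/

section Splitting

variable {π : K →+ K} (hπ : ∀ x y, π (φ x * y) = x * π y)
  (hR : ∀ (i : C.I) (c : C.R i), ∃ c', C.e i c' = π (C.e i c))

include hπ hR

omit C hR in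
lemma map_frob_pow_mul (x : K) (n : ℕ) (y : K) : π (φ x ^ n * y) = x ^ n * π y := by
  rw [← map_pow, hπ]

/-- Over a basic open set of `f` in a chart, `b` becomes `c / φ(f) ^ n` in `K`. Semilinearity turns
this into `π c / f ^ n`, and `π c` is again in the chart ring, so the image is a function. -/
lemma exists_transform (U : Y.Opens) (b : Γ(Y, F ⁻¹ᵁ U)) :
    ∃ s : Γ(Y, U), ∀ h, evalPoint g U h s = π (evalPoint g (F ⁻¹ᵁ U) (C.top_le_frob h) b) := by
  by_cases h : ⊤ ≤ g ⁻¹ᵁ U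
  · obtain ⟨s, hs⟩ := C.exists_section (U := U)
      (π (evalPoint g (F ⁻¹ᵁ U) (C.top_le_frob h) b)) fun i f hf hfU => by
        obtain ⟨n, c, hc⟩ := exists_specRes_eq (C.frob i f)
          ((C.ι i).appLE _ (basicOpens (C.frob i f)) (le_preimage_frob hfU) b)
        have h1 := evalPoint_mul_pow (C.e_ι i) (C.e_frob_ne_zero hf) (le_preimage_frob hfU) hc
          (C.top_le_frob h)
        obtain ⟨c', hc'⟩ := hR i c
        refine ⟨n, c', ?_⟩
        rw [hc', ← h1, C.e_frob, mul_comm (evalPoint _ _ _ _), map_frob_pow_mul hπ, mul_comm]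
    exact ⟨s, fun _ => hs _⟩
  -- A nonempty open set contains the generic point, so `U` is empty here and any section will do.
  · exact ⟨0, fun h' => absurd h' h⟩

/-- The splitting defined by a splitting of the field `K` that preserves the charts. -/
noncomputable def splitting (h1 : π 1 = 1) : Splitting F where
  app U := AddMonoidHom.mk' (fun b => (C.exists_transform hπ hR U b).choose) (by
    intro a b
    refine C.eq_of_evalPoint fun h => ?_
    rw [map_add, (C.exists_transform hπ hR U _).choose_spec,
      (C.exists_transform hπ hR U _).choose_spec, (C.exists_transform hπ hR U _).choose_spec,
      map_add, map_add])
  map_smul U a b := by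
    refine C.eq_of_evalPoint fun h => ?_
    change evalPoint g U h (C.exists_transform hπ hR U _).choose =
      evalPoint g U h (a * (C.exists_transform hπ hR U _).choose)
    rw [map_mul, (C.exists_transform hπ hR U _).choose_spec,
      (C.exists_transform hπ hR U _).choose_spec, map_mul, evalPoint_app g C.g_frob U h, hπ]
  naturality {U V} i b := by
    refine C.eq_of_evalPoint fun h => ?_
    refine Eq.trans ?_ (evalPoint_map g i h _).symm
    change evalPoint g U h (C.exists_transform hπ hR U _).choose =
      evalPoint g V _ (C.exists_transform hπ hR V _).choose
    rw [(C.exists_transform hπ hR U _).choose_spec, (C.exists_transform hπ hR V _).choose_spec,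
      evalPoint_map g (F.preimage_mono i)]
  split U a := by
    refine C.eq_of_evalPoint fun h => ?_
    change evalPoint g U h (C.exists_transform hπ hR U _).choose = _
    rw [(C.exists_transform hπ hR U _).choose_spec, evalPoint_app g C.g_frob U h,
      ← mul_one (φ _), hπ, h1, mul_one]

lemma evalPoint_splitting (h1 : π 1 = 1) (U : Y.Opens) (b : Γ(Y, F ⁻¹ᵁ U)) (h : ⊤ ≤ g ⁻¹ᵁ U) :
    evalPoint g U h ((C.splitting hπ hR h1).app U b) =
      π (evalPoint g (F ⁻¹ᵁ U) (C.top_le_frob h) b) :=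
  (C.exists_transform hπ hR U b).choose_spec h

/-- Vanishing on `Z` is local, so it is enough that on charts covering `Z` the kernel of `p` is
preserved. Sections over basic open sets reduce to elements of the chart ring by clearing
denominators. -/
lemma splitting_isCompatible (h1 : π 1 = 1) {Z : Scheme.{u}} (j : Z ⟶ Y)
    (hj : ∀ z : Z, ∃ (i : C.I) (A : CommRingCat.{u}) (p : C.R i ⟶ A) (κ : Spec A ⟶ Z) (x : Spec A),
      IsOpenImmersion κ ∧ κ x = z ∧ Spec.map p ≫ C.ι i = κ ≫ j ∧
      ∀ c c', C.e i c' = π (C.e i c) → p c = 0 → p c' = 0) :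
    (C.splitting hπ hR h1).IsCompatible j := by
  intro U b hb
  change j.app U _ = 0
  replace hb : j.app (F ⁻¹ᵁ U) b = 0 := hb
  set s := (C.splitting hπ hR h1).app U b with hs
  have key : ∀ z : (j ⁻¹ᵁ U : Z.Opens), ∃ W : Z.Opens, ∃ (hW : W ≤ j ⁻¹ᵁ U), z.1 ∈ W ∧
      Z.presheaf.map (homOfLE hW).op (j.app U s) = 0 := by
    rintro ⟨z, hz⟩
    obtain ⟨i, A, p, κ, x, hκ, rfl, hpκ, hker⟩ := hj z
    have hx : Spec.map p x ∈ C.ι i ⁻¹ᵁ U := by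
      change (Spec.map p ≫ C.ι i) x ∈ U
      rw [hpκ]
      exact hz
    obtain ⟨f, hxf, hfU⟩ := Toric.exists_basicOpens hx
    have hf : C.e i f ≠ 0 :=
      (map_ne_zero_iff _ (C.e_injective i)).2 (ne_zero_of_mem_basicOpens hxf)
    have pull : ∀ (U : Y.Opens) (f : C.R i) (hfU : basicOpens f ≤ C.ι i ⁻¹ᵁ U),
        ∃ hV : basicOpens (p f) ≤ κ ⁻¹ᵁ j ⁻¹ᵁ U, ∀ t : Γ(Y, U),
          κ.appLE (j ⁻¹ᵁ U) (basicOpens (p f)) hV (j.app U t) =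
            (Spec.map p).appLE (basicOpens f) (basicOpens (p f)) (le_preimage_basicOpens p)
              ((C.ι i).appLE U (basicOpens f) hfU t) := by
      intro U f hfU
      have hV' : basicOpens (p f) ≤ (Spec.map p ≫ C.ι i) ⁻¹ᵁ U := fun y hy =>
        hfU (le_preimage_basicOpens p hy)
      have hV : basicOpens (p f) ≤ κ ⁻¹ᵁ j ⁻¹ᵁ U := by
        rw [hpκ] at hV'
        exact hV'
      refine ⟨hV, fun t => ?_⟩
      have h2 := Scheme.Hom.appLE_comp_appLE (Spec.map p) (C.ι i) U (basicOpens f)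
        (basicOpens (p f)) hfU (le_preimage_basicOpens p)
      have h3 := Scheme.Hom.comp_appLE κ j U (basicOpens (p f)) hV
      exact congrArg (fun ψ => ψ.hom t)
        (h3.symm.trans ((appLE_congr_hom hpκ.symm hV hV').trans h2.symm))
    obtain ⟨hV, hpull⟩ := pull U f hfU
    obtain ⟨hVF, hpullF⟩ := pull (F ⁻¹ᵁ U) (C.frob i f) (le_preimage_frob hfU)
    refine ⟨κ ''ᵁ basicOpens (p f), image_le κ hV, ⟨x, hxf, rfl⟩,
      map_eq_zero_of_appLE_eq_zero κ hV (image_le κ hV) ?_⟩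
    have hgU := top_le_of_chart (C.e_ι i) hf hfU
    obtain ⟨n, c', hc'⟩ := exists_specRes_eq f ((C.ι i).appLE U (basicOpens f) hfU s)
    obtain ⟨m, c, hc⟩ := exists_specRes_eq (C.frob i f)
      ((C.ι i).appLE (F ⁻¹ᵁ U) (basicOpens (C.frob i f)) (le_preimage_frob hfU) b)
    have e1 := evalPoint_mul_pow (C.e_ι i) hf hfU hc' hgU
    have e2 := evalPoint_mul_pow (C.e_ι i) (C.e_frob_ne_zero hf) (le_preimage_frob hfU) hc
      (C.top_le_frob hgU)
    rw [hs, C.evalPoint_splitting hπ hR h1] at e1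
    have hpc : specRes A (basicOpens (p (C.frob i f))) (p c) = 0 := by
      have h2 := hpullF b
      rw [hb, map_zero] at h2
      have h3 := congrArg
        ((Spec.map p).appLE (basicOpens (C.frob i f)) (basicOpens (p (C.frob i f)))
        (le_preimage_basicOpens p)) hc
      rw [map_mul, ← h2, zero_mul, specRes_appLE_apply] at h3
      exact h3.symm
    -- The numerator `c` of `b` need not lie in the kernel of `p`, only become zero after
    -- localization. An additional power of `frob f` puts it there, and semilinearity carries this
    -- power through `π` as a power of `f`.
    obtain ⟨l, hl⟩ := exists_pow_mul_eq_zero _ hpc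
    obtain ⟨c'', hc''⟩ := hR i (C.frob i f ^ l * c)
    have hpc'' : p c'' = 0 := hker _ _ hc'' (by rw [map_mul, map_pow, hl])
    have hcc : f ^ n * c'' = f ^ (l + m) * c' := by
      apply C.e_injective i
      rw [map_mul, map_mul, map_pow, map_pow, hc'', ← e1, map_mul, map_pow, ← e2, C.e_frob,
        mul_comm (evalPoint _ _ _ _), map_frob_pow_mul hπ, map_frob_pow_mul hπ]
      ring
    have hpc' : specRes A (basicOpens (p f)) (p c') = 0 := by
      have h2 := congrArg (specRes A (basicOpens (p f))) (congrArg p hcc)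
      rw [map_mul, hpc'', mul_zero, map_zero, map_mul, map_mul, map_pow, map_pow] at h2
      exact ((isUnit_specRes (p f)).pow _).mul_right_eq_zero.1 h2.symm
    have h2 := congrArg ((Spec.map p).appLE (basicOpens f) (basicOpens (p f))
      (le_preimage_basicOpens p)) hc'
    rw [map_mul, map_pow, specRes_appLE_apply, specRes_appLE_apply, hpc'] at h2
    rw [hpull]
    exact ((isUnit_specRes (p f)).pow _).mul_left_eq_zero.1 h2
  choose W hW hzW hW0 using key
  refine Z.sheaf.eq_of_locally_eq' W (j ⁻¹ᵁ U) (fun z => homOfLE (hW z))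
    (fun z hz => TopologicalSpace.Opens.mem_iSup.2 ⟨⟨z, hz⟩, hzW _⟩) _ 0 fun z => ?_
  exact (hW0 z).trans (map_zero _).symm

end Splitting

end GenericCharts

/-! ### Splittings of chart rings induced by a splitting -/

section ChartSplitting

variable {Y : Scheme.{u}} {F : Y ⟶ Y} (π : Splitting F) {R : Type u} [CommRing R]
  (ι : Spec (.of R) ⟶ Y)

lemma top_le_preimage_image [IsOpenImmersion ι] : ⊤ ≤ ι ⁻¹ᵁ ι ''ᵁ ⊤ :=
  (Scheme.Hom.preimage_image_eq ι _).ge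

variable [IsOpenImmersion ι] (hι : F ⁻¹ᵁ ι ''ᵁ ⊤ = ι ''ᵁ ⊤)

include hι in
lemma top_le_preimage_frob : ⊤ ≤ ι ⁻¹ᵁ F ⁻¹ᵁ ι ''ᵁ ⊤ := by
  rw [hι]
  exact top_le_preimage_image ι

/-- The additive endomorphism of the coordinate ring of an affine chart induced by a splitting. -/
noncomputable def chartSplitting : R →+ R :=
  (evalPoint ι (ι ''ᵁ ⊤) (top_le_preimage_image ι)).toAddMonoidHom.comp
    ((π.app (ι ''ᵁ ⊤)).comp (RingEquiv.ofBijective _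
      (evalPoint_bijective ι hι (top_le_preimage_frob ι hι))).symm.toAddMonoidHom)

lemma chartSplitting_evalPoint (b : Γ(Y, F ⁻¹ᵁ ι ''ᵁ ⊤)) :
    chartSplitting π ι hι (evalPoint ι _ (top_le_preimage_frob ι hι) b) =
      evalPoint ι _ (top_le_preimage_image ι) (π.app _ b) := by
  have h : (RingEquiv.ofBijective _
      (evalPoint_bijective ι hι (top_le_preimage_frob ι hι))).symm
        (evalPoint ι _ (top_le_preimage_frob ι hι) b) = b :=
    RingEquiv.symm_apply_apply (RingEquiv.ofBijective _
      (evalPoint_bijective ι hι (top_le_preimage_frob ι hι))) b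
  exact congrArg (fun b => evalPoint ι _ (top_le_preimage_image ι) (π.app _ b)) h

variable {φ : R →+* R} (hφ : ι ≫ F = Spec.map (CommRingCat.ofHom φ) ≫ ι)

include hφ

lemma chartSplitting_mul (x y : R) :
    chartSplitting π ι hι (φ x * y) = x * chartSplitting π ι hι y := by
  obtain ⟨a, rfl⟩ := (evalPoint_bijective ι rfl (top_le_preimage_image ι)).2 x
  obtain ⟨b, rfl⟩ := (evalPoint_bijective ι hι (top_le_preimage_frob ι hι)).2 y
  rw [← evalPoint_app ι hφ _ (top_le_preimage_image ι) (top_le_preimage_frob ι hι), ← map_mul,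
    chartSplitting_evalPoint, chartSplitting_evalPoint, π.map_smul, map_mul]

omit hφ

lemma chartSplitting_one : chartSplitting π ι hι 1 = 1 := by
  have h : evalPoint ι _ (top_le_preimage_frob ι hι) (F.app _ 1) = 1 := by
    rw [map_one, map_one]
  exact (congrArg (chartSplitting π ι hι) h.symm).trans (by
    rw [chartSplitting_evalPoint, π.split, map_one])

/-- When one chart factors through another, `r` is restriction of functions, and the claim is the
naturality of `π`. -/
lemma chartSplitting_map {R' : Type u} [CommRing R'] {ι' : Spec (.of R') ⟶ Y} [IsOpenImmersion ι']
    (hι' : F ⁻¹ᵁ ι' ''ᵁ ⊤ = ι' ''ᵁ ⊤) {r : R →+* R'}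
    (hr : Spec.map (CommRingCat.ofHom r) ≫ ι = ι') (x : R) :
    chartSplitting π ι' hι' (r x) = r (chartSplitting π ι hι x) := by
  obtain ⟨b, rfl⟩ := (evalPoint_bijective ι hι (top_le_preimage_frob ι hι)).2 x
  subst hr
  have hle : (Spec.map (CommRingCat.ofHom r) ≫ ι) ''ᵁ ⊤ ≤ ι ''ᵁ ⊤ := by
    rintro _ ⟨x, -, rfl⟩
    exact ⟨Spec.map (CommRingCat.ofHom r) x, Set.mem_univ _, rfl⟩
  have h0 := top_le_preimage_frob _ hι'
  have h1 := top_le_preimage_image (Spec.map (CommRingCat.ofHom r) ≫ ι)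
  rw [← evalPoint_specMap ι r _ _ (h0.trans (Scheme.Hom.preimage_mono _ (F.preimage_mono hle))),
    ← evalPoint_map _ (F.preimage_mono hle) h0, chartSplitting_evalPoint, π.naturality hle,
    evalPoint_map _ hle h1, chartSplitting_evalPoint, evalPoint_specMap ι r]

lemma chartSplitting_eq_zero {Z : Scheme.{u}} {j : Z ⟶ Y} (hπ : π.IsCompatible j) {A : Type u}
    [CommRing A] {κ : Spec (.of A) ⟶ Z} [IsOpenImmersion κ] {p : R →+* A}
    (hp : Spec.map (CommRingCat.ofHom p) ≫ ι = κ ≫ j) (hκ : j ⁻¹ᵁ ι ''ᵁ ⊤ = κ ''ᵁ ⊤) {x : R}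
    (hx : p x = 0) : p (chartSplitting π ι hι x) = 0 := by
  obtain ⟨b, rfl⟩ := (evalPoint_bijective ι hι (top_le_preimage_frob ι hι)).2 x
  have pull : ∀ (U : Y.Opens) (h : ⊤ ≤ ι ⁻¹ᵁ U), ∃ h' : ⊤ ≤ κ ⁻¹ᵁ j ⁻¹ᵁ U, ∀ s : Γ(Y, U),
      evalPoint κ (j ⁻¹ᵁ U) h' (j.app U s) = p (evalPoint ι U h s) := by
    intro U h
    have h1 : ⊤ ≤ (Spec.map (CommRingCat.ofHom p) ≫ ι) ⁻¹ᵁ U := fun x _ => h (Set.mem_univ _)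
    have h2 : ⊤ ≤ (κ ≫ j) ⁻¹ᵁ U := hp ▸ h1
    refine ⟨h2, fun s => ?_⟩
    exact (evalPoint_comp κ j U h2 h2 s).symm.trans
      ((DFunLike.congr_fun (evalPoint_congr hp U h1 h2) s).symm.trans
        (evalPoint_specMap ι p U h h1 s))
  obtain ⟨h1, h1'⟩ := pull _ (top_le_preimage_frob ι hι)
  obtain ⟨h2, h2'⟩ := pull _ (top_le_preimage_image ι)
  have hb : j.app _ b = 0 := by
    refine (evalPoint_bijective κ (by rw [hι, hκ]) h1).1 ?_
    rw [h1', hx, map_zero]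
  have hb' : j.app _ (π.app _ b) = 0 := hπ _ b hb
  rw [chartSplitting_evalPoint, ← h2', hb', map_zero]

end ChartSplitting

/-! ### The charts of a toric variety and of its square -/

section ToricCharts

lemma hom_congr_apply {X Y : Scheme.{u}} {f g : X ⟶ Y} (h : f = g) (x : X) : f x = g x := by
  rw [h]

lemma specMap_comp_eq {A B C : Type u} [CommRing A] [CommRing B] [CommRing C] {f : A →+* B}
    {g : B →+* C} {h : A →+* C} (H : ∀ x, g (f x) = h x) :
    Spec.map (CommRingCat.ofHom g) ≫ Spec.map (CommRingCat.ofHom f) =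
      Spec.map (CommRingCat.ofHom h) := by
  rw [← Spec.map_comp, ← CommRingCat.ofHom_comp]
  congr 2
  exact RingHom.ext H

lemma specMap_comm {A B C D : Type u} [CommRing A] [CommRing B] [CommRing C] [CommRing D]
    {f : A →+* B} {g : B →+* D} {f' : A →+* C} {g' : C →+* D} (H : ∀ x, g (f x) = g' (f' x)) :
    Spec.map (CommRingCat.ofHom g) ≫ Spec.map (CommRingCat.ofHom f) =
      Spec.map (CommRingCat.ofHom g') ≫ Spec.map (CommRingCat.ofHom f') :=
  (specMap_comp_eq H).trans (specMap_comp_eq (h := g'.comp f') fun _ => rfl).symm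

variable (k : Type u) [Field k] {N : Type u} [AddCommGroup N] (S : Fan N)

/-- The inclusion of the affine chart `U_σ`. -/
noncomputable def chartι (σ : S.cones) : Spec (.of (ChartRing k σ.1)) ⟶ toricVariety k S :=
  colimit.ι (chartFunctor k S) σ

instance isOpenImmersion_chartι (σ : S.cones) : IsOpenImmersion (chartι k S σ) :=
  inferInstanceAs (IsOpenImmersion (colimit.ι (chartFunctor k S) σ))

lemma exists_chartι (x : toricVariety k S) : ∃ σ y, chartι k S σ y = x :=
  Scheme.IsLocallyDirected.ι_jointly_surjective (chartFunctor k S) x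

lemma chartι_structureMap (σ : S.cones) : chartι k S σ ≫ structureMap k S =
    Spec.map (CommRingCat.ofHom (algebraMap k (ChartRing k σ.1))) :=
  colimit.ι_desc _ _

lemma chartι_frobenius (q : ℕ) (σ : S.cones) : chartι k S σ ≫ frobenius k S q =
    Spec.map (CommRingCat.ofHom (chartFrobenius k σ.1 q).toRingHom) ≫ chartι k S σ :=
  ι_colimMap _ _

lemma specMap_chartMap_chartι {τ σ : S.cones} (h : τ.1 ≤ σ.1) :
    Spec.map (CommRingCat.ofHom (chartMap k h).toRingHom) ≫ chartι k S σ = chartι k S τ :=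
  colimit.w (chartFunctor k S) (homOfLE h : τ ⟶ σ)

/-- Within another chart, the overlap with `U_σ` is the locus where a monomial is invertible. The
endomorphism pulls this monomial back to its `q`-th power, which has the same nonvanishing locus. -/
lemma frobenius_preimage {q : ℕ} (hq : 0 < q) (σ : S.cones) :
    frobenius k S q ⁻¹ᵁ chartι k S σ ''ᵁ ⊤ = chartι k S σ ''ᵁ ⊤ := by
  ext x
  constructor
  · rintro ⟨y, -, hy⟩
    obtain ⟨τ, z, rfl⟩ := exists_chartι k S x
    have h1 : chartι k S τ (Spec.map (CommRingCat.ofHom (chartFrobenius k τ.1 q).toRingHom) z) =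
        chartι k S σ y := by
      exact (hom_congr_apply (chartι_frobenius k S q τ) z).symm.trans hy.symm
    obtain ⟨ρ, f, f', w, hw, -⟩ :=
      (Scheme.IsLocallyDirected.ι_eq_ι_iff (chartFunctor k S)).1 h1
    obtain ⟨m, hm, -⟩ := exists_isLocalization k S (leOfHom f)
    have hrange := range_chart k S f m hm
    have hz : z ∈ Set.range ((chartFunctor k S).map f) := by
      have h2 : Spec.map (CommRingCat.ofHom (chartFrobenius k τ.1 q).toRingHom) z ∈
          Set.range ((chartFunctor k S).map f) := ⟨w, hw⟩
      rw [hrange] at h2 ⊢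
      intro hz
      refine h2 ?_
      change chartFrobenius k τ.1 q (AddMonoidAlgebra.single m 1) ∈ z.asIdeal
      have h3 : chartFrobenius k τ.1 q (AddMonoidAlgebra.single m 1) =
          (AddMonoidAlgebra.single m 1) ^ q := by
        rw [chartFrobenius_single, AddMonoidAlgebra.single_pow, one_pow]
      rw [h3]
      exact Ideal.pow_mem_of_mem _ hz q hq
    obtain ⟨w', hw'⟩ := hz
    refine ⟨(chartFunctor k S).map f' w', Set.mem_univ _, ?_⟩
    rw [← hw']
    exact (Scheme.IsLocallyDirected.ι_eq_ι_iff (chartFunctor k S)).2 ⟨ρ, f', f, w', rfl, rfl⟩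
  · rintro ⟨y, -, rfl⟩
    refine ⟨Spec.map (CommRingCat.ofHom (chartFrobenius k σ.1 q).toRingHom) y, Set.mem_univ _, ?_⟩
    exact (hom_congr_apply (chartι_frobenius k S q σ) y).symm

/-- The coordinate ring of the affine chart `U_σ × U_τ`. -/
abbrev SquareRing (σ τ : S.cones) : Type u := ChartRing k σ.1 ⊗[k] ChartRing k τ.1

/-- The inclusion of the affine chart `U_σ × U_τ`. -/
noncomputable def squareι (σ τ : S.cones) : Spec (.of (SquareRing k S σ τ)) ⟶ square k S :=
  (pullbackSpecIso k (ChartRing k σ.1) (ChartRing k τ.1)).inv ≫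
    pullback.map _ _ _ _ (chartι k S σ) (chartι k S τ) (𝟙 _)
      (by rw [chartι_structureMap, Category.comp_id])
      (by rw [chartι_structureMap, Category.comp_id])

instance isOpenImmersion_squareι (σ τ : S.cones) : IsOpenImmersion (squareι k S σ τ) := by
  unfold squareι
  infer_instance

lemma squareι_fst (σ τ : S.cones) : squareι k S σ τ ≫ pullback.fst _ _ =
    Spec.map (CommRingCat.ofHom (Algebra.TensorProduct.includeLeftRingHom
      (R := k) (A := ChartRing k σ.1) (B := ChartRing k τ.1))) ≫ chartι k S σ := by
  rw [squareι, Category.assoc, pullback.map, pullback.lift_fst, pullbackSpecIso_inv_fst_assoc]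

lemma squareι_snd (σ τ : S.cones) : squareι k S σ τ ≫ pullback.snd _ _ =
    Spec.map (CommRingCat.ofHom (Algebra.TensorProduct.includeRight
      (R := k) (A := ChartRing k σ.1) (B := ChartRing k τ.1)).toRingHom) ≫ chartι k S τ := by
  rw [squareι, Category.assoc, pullback.map, pullback.lift_snd, pullbackSpecIso_inv_snd_assoc]
  rfl

lemma image_squareι (σ τ : S.cones) : squareι k S σ τ ''ᵁ ⊤ =
    pullback.fst (structureMap k S) (structureMap k S) ⁻¹ᵁ chartι k S σ ''ᵁ ⊤ ⊓
      pullback.snd (structureMap k S) (structureMap k S) ⁻¹ᵁ chartι k S τ ''ᵁ ⊤ := by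
  ext y
  constructor
  · rintro ⟨z, -, rfl⟩
    exact ⟨⟨_, Set.mem_univ _, (hom_congr_apply (squareι_fst k S σ τ) z).symm⟩,
      ⟨_, Set.mem_univ _, (hom_congr_apply (squareι_snd k S σ τ) z).symm⟩⟩
  · rintro ⟨⟨x, -, hx⟩, ⟨x', -, hx'⟩⟩
    have h : y ∈ Set.range (pullback.map _ _ _ _ (chartι k S σ) (chartι k S τ) (𝟙 _)
        (by rw [chartι_structureMap, Category.comp_id])
        (by rw [chartι_structureMap, Category.comp_id])) := by
      rw [Scheme.Pullback.range_map]
      exact ⟨⟨x, hx⟩, ⟨x', hx'⟩⟩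
    obtain ⟨w, hw⟩ := h
    refine ⟨(pullbackSpecIso k (ChartRing k σ.1) (ChartRing k τ.1)).hom w, Set.mem_univ _, ?_⟩
    refine Eq.trans ?_ hw
    exact hom_congr_apply (Iso.hom_inv_id_assoc
      (pullbackSpecIso k (ChartRing k σ.1) (ChartRing k τ.1)) _) w

lemma exists_squareι (y : square k S) : ∃ σ τ x, squareι k S σ τ x = y := by
  obtain ⟨σ, x, hx⟩ := exists_chartι k S (pullback.fst (structureMap k S) (structureMap k S) y)
  obtain ⟨τ, x', hx'⟩ := exists_chartι k S (pullback.snd (structureMap k S) (structureMap k S) y)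
  have h : y ∈ squareι k S σ τ ''ᵁ ⊤ := by
    rw [image_squareι]
    exact ⟨⟨x, Set.mem_univ _, hx⟩, ⟨x', Set.mem_univ _, hx'⟩⟩
  obtain ⟨z, -, hz⟩ := h
  exact ⟨σ, τ, z, hz⟩

lemma squareFrobenius_fst (q : ℕ) : squareFrobenius k S q ≫ pullback.fst _ _ =
    pullback.fst _ _ ≫ frobenius k S q :=
  pullback.lift_fst _ _ _

lemma squareFrobenius_snd (q : ℕ) : squareFrobenius k S q ≫ pullback.snd _ _ =
    pullback.snd _ _ ≫ frobenius k S q :=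
  pullback.lift_snd _ _ _

lemma squareι_squareFrobenius (q : ℕ) (σ τ : S.cones) :
    squareι k S σ τ ≫ squareFrobenius k S q =
      Spec.map (CommRingCat.ofHom (Algebra.TensorProduct.map (chartFrobenius k σ.1 q)
        (chartFrobenius k τ.1 q)).toRingHom) ≫ squareι k S σ τ := by
  have h1 := specMap_comm
    (f := Algebra.TensorProduct.includeLeftRingHom (R := k) (A := ChartRing k σ.1)
      (B := ChartRing k τ.1))
    (g := (Algebra.TensorProduct.map (chartFrobenius k σ.1 q) (chartFrobenius k τ.1 q)).toRingHom)
    (f' := (chartFrobenius k σ.1 q).toRingHom)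
    (g' := Algebra.TensorProduct.includeLeftRingHom) (fun x => by simp)
  have h2 := specMap_comm
    (f := (Algebra.TensorProduct.includeRight (R := k) (A := ChartRing k σ.1)
      (B := ChartRing k τ.1)).toRingHom)
    (g := (Algebra.TensorProduct.map (chartFrobenius k σ.1 q) (chartFrobenius k τ.1 q)).toRingHom)
    (f' := (chartFrobenius k τ.1 q).toRingHom)
    (g' := (Algebra.TensorProduct.includeRight (R := k)).toRingHom) (fun x => by simp)
  apply pullback.hom_ext
  · rw [Category.assoc, Category.assoc, squareFrobenius_fst, squareι_fst, ← Category.assoc,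
      squareι_fst, Category.assoc, chartι_frobenius, ← Category.assoc, ← h1, Category.assoc]
  · rw [Category.assoc, Category.assoc, squareFrobenius_snd, squareι_snd, ← Category.assoc,
      squareι_snd, Category.assoc, chartι_frobenius, ← Category.assoc, ← h2, Category.assoc]

lemma specMap_squareι {σ τ σ' τ' : S.cones} (h : σ'.1 ≤ σ.1) (h' : τ'.1 ≤ τ.1) :
    Spec.map (CommRingCat.ofHom (Algebra.TensorProduct.map (chartMap k h)
        (chartMap k h')).toRingHom) ≫ squareι k S σ τ = squareι k S σ' τ' := by
  have h1 := specMap_comm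
    (f := Algebra.TensorProduct.includeLeftRingHom (R := k) (A := ChartRing k σ.1)
      (B := ChartRing k τ.1))
    (g := (Algebra.TensorProduct.map (chartMap k h) (chartMap k h')).toRingHom)
    (f' := (chartMap k h).toRingHom)
    (g' := Algebra.TensorProduct.includeLeftRingHom) (fun x => by simp)
  have h2 := specMap_comm
    (f := (Algebra.TensorProduct.includeRight (R := k) (A := ChartRing k σ.1)
      (B := ChartRing k τ.1)).toRingHom)
    (g := (Algebra.TensorProduct.map (chartMap k h) (chartMap k h')).toRingHom)
    (f' := (chartMap k h').toRingHom)
    (g' := (Algebra.TensorProduct.includeRight (R := k)).toRingHom) (fun x => by simp)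
  apply pullback.hom_ext
  · rw [Category.assoc, squareι_fst, squareι_fst, ← specMap_chartMap_chartι k S h,
      ← Category.assoc, ← Category.assoc, h1]
  · rw [Category.assoc, squareι_snd, squareι_snd, ← specMap_chartMap_chartι k S h',
      ← Category.assoc, ← Category.assoc, h2]

lemma specMap_lmul_squareι (σ : S.cones) :
    Spec.map (CommRingCat.ofHom (Algebra.TensorProduct.lmul' k (S := ChartRing k σ.1)).toRingHom) ≫
      squareι k S σ σ = chartι k S σ ≫ diagonal k S := by
  have h1 := specMap_comp_eq (f := Algebra.TensorProduct.includeLeftRingHom (R := k)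
    (A := ChartRing k σ.1) (B := ChartRing k σ.1))
    (g := (Algebra.TensorProduct.lmul' k (S := ChartRing k σ.1)).toRingHom) (h := RingHom.id _)
    (fun x => by simp)
  have h2 := specMap_comp_eq (f := (Algebra.TensorProduct.includeRight (R := k)
    (A := ChartRing k σ.1) (B := ChartRing k σ.1)).toRingHom)
    (g := (Algebra.TensorProduct.lmul' k (S := ChartRing k σ.1)).toRingHom) (h := RingHom.id _)
    (fun x => by simp)
  have h3 : Spec.map (CommRingCat.ofHom (RingHom.id (ChartRing k σ.1))) = 𝟙 _ := Spec.map_id _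
  rw [h3] at h1 h2
  apply pullback.hom_ext
  · rw [Category.assoc, squareι_fst, ← Category.assoc, h1, Category.assoc,
      pullback.diagonal_fst, Category.comp_id, Category.id_comp]
  · rw [Category.assoc, squareι_snd, ← Category.assoc, h2, Category.assoc,
      pullback.diagonal_snd, Category.comp_id, Category.id_comp]

lemma squareFrobenius_preimage {q : ℕ} (hq : 0 < q) (σ τ : S.cones) :
    squareFrobenius k S q ⁻¹ᵁ squareι k S σ τ ''ᵁ ⊤ = squareι k S σ τ ''ᵁ ⊤ := by
  rw [image_squareι]
  conv_rhs => rw [← frobenius_preimage k S hq σ, ← frobenius_preimage k S hq τ]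
  ext y
  have h1 := hom_congr_apply (squareFrobenius_fst k S q) y
  have h2 := hom_congr_apply (squareFrobenius_snd k S q) y
  simp only [Scheme.Hom.comp_apply] at h1 h2
  change _ ∈ chartι k S σ ''ᵁ ⊤ ∧ _ ∈ chartι k S τ ''ᵁ ⊤ ↔
    _ ∈ chartι k S σ ''ᵁ ⊤ ∧ _ ∈ chartι k S τ ''ᵁ ⊤
  rw [h1, h2]

lemma diagonal_preimage (σ : S.cones) :
    diagonal k S ⁻¹ᵁ squareι k S σ σ ''ᵁ ⊤ = chartι k S σ ''ᵁ ⊤ := by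
  rw [image_squareι]
  ext y
  have h1 := hom_congr_apply (pullback.diagonal_fst (structureMap k S)) y
  have h2 := hom_congr_apply (pullback.diagonal_snd (structureMap k S)) y
  simp only [Scheme.Hom.comp_apply] at h1 h2
  change _ ∈ chartι k S σ ''ᵁ ⊤ ∧ _ ∈ chartι k S σ ''ᵁ ⊤ ↔ _
  rw [h1, h2]
  exact and_self_iff

end ToricCharts

/-! ### Diagonal splittings and small residues -/

section DiagonalSplitting

variable (k : Type u) [Field k] {N : Type u} [AddCommGroup N] (S : Fan N)

/-- The cone `{0}` of a fan. -/
abbrev Fan.zero : S.cones := ⟨⊥, S.bot_mem⟩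

lemma Fan.zero_le (σ : S.cones) : (Fan.zero S).1 ≤ σ.1 := bot_le

lemma mem_dualMonoid_bot (m : Module.Dual ℤ N) :
    m ∈ dualMonoid (⊥ : PointedCone ℝ (RealSpace N)) := by
  intro x hx
  rw [(Submodule.mem_bot _).1 hx, map_zero]

lemma squareChart_bot_bijective : Function.Bijective
    (squareChart k (⊥ : PointedCone ℝ (RealSpace N)) (⊥ : PointedCone ℝ (RealSpace N))) :=
  ⟨squareChart_injective _ _, fun _ => mem_range_squareChart.2 fun _ _ =>
    ⟨mem_dualMonoid_bot _, mem_dualMonoid_bot _⟩⟩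

/-- The additive endomorphism of `k[M × M]` induced by a splitting. -/
noncomputable def torusPart {q : ℕ} (hq : 0 < q) (π : Splitting (squareFrobenius k S q)) :
    TorusRing k N →+ TorusRing k N :=
  (squareChart k ⊥ ⊥).toRingHom.toAddMonoidHom.comp
    ((chartSplitting π (squareι k S S.zero S.zero)
      (squareFrobenius_preimage k S hq S.zero S.zero)).comp
      (AlgEquiv.ofBijective _ (squareChart_bot_bijective k
        (N := N))).symm.toAddEquiv.toAddMonoidHom)

variable {k S}

lemma torusPart_squareChart_bot {q : ℕ} (hq : 0 < q) (π : Splitting (squareFrobenius k S q))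
    (x : SquareRing k S S.zero S.zero) :
    torusPart k S hq π (squareChart k ⊥ ⊥ x) = squareChart k ⊥ ⊥
      (chartSplitting π (squareι k S S.zero S.zero)
        (squareFrobenius_preimage k S hq S.zero S.zero) x) := by
  have h : (AlgEquiv.ofBijective _ (squareChart_bot_bijective k (N := N))).symm
      (squareChart k ⊥ ⊥ x) = x :=
    AlgEquiv.symm_apply_apply (AlgEquiv.ofBijective _ (squareChart_bot_bijective k)) x
  exact congrArg (fun y => squareChart k ⊥ ⊥ (chartSplitting π (squareι k S S.zero S.zero)
        (squareFrobenius_preimage k S hq S.zero S.zero) y)) h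

/-- Restriction from `U_σ × U_τ` to `T × T` commutes with the splitting. Hence its torus part
preserves the functions regular on each chart. -/
lemma torusPart_squareChart {q : ℕ} (hq : 0 < q) (π : Splitting (squareFrobenius k S q))
    (σ τ : S.cones) (x : SquareRing k S σ τ) :
    torusPart k S hq π (squareChart k σ.1 τ.1 x) = squareChart k σ.1 τ.1
      (chartSplitting π (squareι k S σ τ) (squareFrobenius_preimage k S hq σ τ) x) := by
  rw [← squareChart_comp_map (S.zero_le σ) (S.zero_le τ) x,
    ← squareChart_comp_map (S.zero_le σ) (S.zero_le τ)]
  refine (torusPart_squareChart_bot hq π _).trans (congrArg (squareChart k ⊥ ⊥) ?_)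
  exact chartSplitting_map π (squareι k S σ τ) (squareFrobenius_preimage k S hq σ τ)
    (squareFrobenius_preimage k S hq S.zero S.zero)
    (specMap_squareι k S (S.zero_le σ) (S.zero_le τ)) x

lemma IsDiagonallySplit.hasSmallResidues (b : Module.Basis (Fin 2) ℤ N) {q : ℕ} (hq : 0 < q)
    (h : IsDiagonallySplit k S q) : HasSmallResidues S.rays q := by
  obtain ⟨π, hπ⟩ := h
  have hsurj := (squareChart_bot_bijective k (N := N)).2
  refine hasSmallResidues_of_splitting b hq (fun v hv => hv.1) (torusPart k S hq π) ?_ ?_ ?_ ?_ ?_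
  · rw [← map_one (squareChart k ⊥ ⊥)]
    refine (torusPart_squareChart_bot hq π 1).trans ?_
    exact congrArg _ (chartSplitting_one π _ _)
  · intro x y
    obtain ⟨x, rfl⟩ := hsurj x
    obtain ⟨y, rfl⟩ := hsurj y
    rw [← squareChart_chartFrobenius, ← map_mul]
    refine (torusPart_squareChart_bot hq π _).trans ?_
    refine (congrArg (squareChart k ⊥ ⊥) (chartSplitting_mul π _ _
      (squareι_squareFrobenius k S q S.zero S.zero) x y)).trans ?_
    refine (map_mul (squareChart k ⊥ ⊥) _ _).trans ?_
    exact congrArg _ (torusPart_squareChart_bot hq π _).symm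
  · rintro v hv _ ⟨x, rfl⟩
    exact ⟨_, (torusPart_squareChart hq π ⟨_, hv.2⟩ S.zero x).symm⟩
  · rintro v hv _ ⟨x, rfl⟩
    exact ⟨_, (torusPart_squareChart hq π S.zero ⟨_, hv.2⟩ x).symm⟩
  · intro x hx
    obtain ⟨x, rfl⟩ := hsurj x
    rw [torusDiagonal_squareChart_eq_zero_iff] at hx
    refine (congrArg (torusDiagonal k N) (torusPart_squareChart_bot hq π _)).trans ?_
    refine (torusDiagonal_squareChart_eq_zero_iff _).2 ?_
    exact chartSplitting_eq_zero π _ _ hπ (specMap_lmul_squareι k S S.zero)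
      (diagonal_preimage k S S.zero) hx

/-- The embedding of the coordinate ring of a chart of `X × X` into the function field. -/
noncomputable def squareEval (σ τ : S.cones) :
    SquareRing k S σ τ →+* FractionRing (TorusRing k N) :=
  (algebraMap (TorusRing k N) (FractionRing (TorusRing k N))).comp
    (squareChart k σ.1 τ.1).toRingHom

/-- The torus chart is contained in every other chart, so all embeddings into the function field
define the same generic point. -/
lemma squareEval_specMap_squareι (σ τ : S.cones) :
    Spec.map (CommRingCat.ofHom (squareEval (k := k) σ τ)) ≫ squareι k S σ τ =
      Spec.map (CommRingCat.ofHom (squareEval S.zero S.zero)) ≫ squareι k S S.zero S.zero := by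
  rw [← specMap_squareι k S (S.zero_le σ) (S.zero_le τ), ← Category.assoc]
  refine congrArg (· ≫ squareι k S σ τ) (specMap_comp_eq fun x => ?_).symm
  exact congrArg (algebraMap _ _) (squareChart_comp_map (S.zero_le σ) (S.zero_le τ) x)

variable [Module.Free ℤ N] [Module.Finite ℤ N]

/-- The endomorphism `F` of the function field of the square of the torus. -/
noncomputable def fieldFrobenius (k : Type u) [Field k] (N : Type u) [AddCommGroup N]
    [Module.Free ℤ N] [Module.Finite ℤ N] {q : ℕ} (hq : 0 < q) :
    FractionRing (TorusRing k N) →+* FractionRing (TorusRing k N) :=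
  IsFractionRing.lift (A := TorusRing k N)
    (g := (algebraMap _ (FractionRing (TorusRing k N))).comp (torusFrobenius k N q).toRingHom)
    ((IsFractionRing.injective (TorusRing k N) _).comp (torusFrobenius_injective hq))

lemma fieldFrobenius_algebraMap {q : ℕ} (hq : 0 < q) (x : TorusRing k N) :
    fieldFrobenius k N hq (algebraMap _ _ x) = algebraMap _ _ (torusFrobenius k N q x) :=
  IsFractionRing.lift_algebraMap _ x

variable (k S)

/-- The charts `U_σ × U_τ` of `X × X`, with the generic point of the torus. -/
noncomputable def squareCharts {q : ℕ} (hq : 0 < q) :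
    GenericCharts (squareFrobenius k S q)
      (Spec.map (CommRingCat.ofHom (squareEval S.zero S.zero)) ≫ squareι k S S.zero S.zero)
      (fieldFrobenius k N hq) where
  I := S.cones × S.cones
  R i := .of (SquareRing k S i.1 i.2)
  ι i := squareι k S i.1 i.2
  isOpenImmersion i := isOpenImmersion_squareι k S i.1 i.2
  exists_eq y := by
    obtain ⟨σ, τ, x, hx⟩ := exists_squareι k S y
    exact ⟨(σ, τ), x, hx⟩
  frob i := CommRingCat.ofHom (Algebra.TensorProduct.map (chartFrobenius k i.1.1 q)
    (chartFrobenius k i.2.1 q)).toRingHom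
  ι_frob i := squareι_squareFrobenius k S q i.1 i.2
  e i := CommRingCat.ofHom (squareEval i.1 i.2)
  e_injective i := (IsFractionRing.injective (TorusRing k N) _).comp (squareChart_injective _ _)
  e_ι i := squareEval_specMap_squareι i.1 i.2
  e_frob i x := (congrArg (algebraMap _ _) (squareChart_chartFrobenius q x)).trans
    (fieldFrobenius_algebraMap hq _).symm
  g_frob := by
    rw [Category.assoc, squareι_squareFrobenius, ← Category.assoc, ← Category.assoc]
    refine congrArg (· ≫ squareι k S S.zero S.zero) (specMap_comm fun x => ?_)
    exact (congrArg (algebraMap _ _) (squareChart_chartFrobenius q x)).trans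
      (fieldFrobenius_algebraMap hq _).symm

lemma HasSmallResidues.isDiagonallySplit (b : Module.Basis (Fin 2) ℤ N) {q : ℕ} (hq : 0 < q)
    (h : HasSmallResidues S.rays q) : IsDiagonallySplit k S q := by
  obtain ⟨d, hd, hd0, hdV⟩ := h.exists_quotient hq
  obtain ⟨π, hπ, hπA⟩ := exists_fractionField_extension (torusFrobenius k N q).toRingHom
    (fieldFrobenius k N hq) (fieldFrobenius_algebraMap hq)
    (fun x hx => exists_mul_eq_torusFrobenius hq hx) (torusSplitting k q d).toAddMonoidHom
    (torusSplitting_mul hq hd)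
  have hinj := IsFractionRing.injective (TorusRing k N) (FractionRing (TorusRing k N))
  have h1 : π 1 = 1 := by
    rw [← map_one (algebraMap (TorusRing k N) _), hπA]
    exact congrArg _ (torusSplitting_one hq hd0)
  have hR : ∀ (i : (squareCharts k S hq).I) (c : (squareCharts k S hq).R i),
      ∃ c', (squareCharts k S hq).e i c' = π ((squareCharts k S hq).e i c) := by
    rintro ⟨σ, τ⟩ c
    -- Small residues only control values on `Σ(1)`, so regularity on a chart has to be tested on
    -- the rays of its cone.
    have hdual : ∀ (σ : S.cones) (m : Module.Dual ℤ N), m ∈ dualMonoid σ.1 ↔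
        ∀ v ∈ {v ∈ S.rays | (1 : ℝ) ⊗ₜ[ℤ] v ∈ σ.1}, 0 ≤ m v := by
      refine fun σ m => ⟨fun hm v hv => ?_, fun hm => S.mem_dualMonoid b σ.2 fun v hv hvσ =>
        hm v ⟨hv, hvσ⟩⟩
      have := hm _ hv.2
      rw [pairing_tmul, one_mul] at this
      exact_mod_cast this
    obtain ⟨c', hc'⟩ := torusSplitting_mem_range hq hdV (Set.sep_subset _ _) (Set.sep_subset _ _)
      (hdual σ) (hdual τ) ⟨c, rfl⟩
    exact ⟨c', (congrArg (algebraMap _ _) hc').trans (hπA _).symm⟩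
  refine ⟨(squareCharts k S hq).splitting hπ hR h1,
    (squareCharts k S hq).splitting_isCompatible hπ hR h1 _ fun z => ?_⟩
  obtain ⟨σ, x, hx⟩ := exists_chartι k S z
  refine ⟨(σ, σ), .of (ChartRing k σ.1),
    CommRingCat.ofHom (Algebra.TensorProduct.lmul' k (S := ChartRing k σ.1)).toRingHom,
    chartι k S σ, x, inferInstance, hx, specMap_lmul_squareι k S σ, fun c c' hc hc0 => ?_⟩
  have hc1 : squareChart k σ.1 σ.1 c' = torusSplitting k q d (squareChart k σ.1 σ.1 c) :=
    hinj (hc.trans (hπA _))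
  refine (torusDiagonal_squareChart_eq_zero_iff _).1 ?_
  replace hc0 := (torusDiagonal_squareChart_eq_zero_iff _).2 hc0
  rw [hc1]
  ext s
  rw [coeff_torusDiagonal_torusSplitting hq, hc0]
  rfl

lemma isDiagonallySplit_iff (b : Module.Basis (Fin 2) ℤ N) {q : ℕ} (hq : 0 < q) :
    IsDiagonallySplit k S q ↔ HasSmallResidues S.rays q :=
  ⟨fun h => h.hasSmallResidues b hq, fun h => h.isDiagonallySplit k S b hq⟩

end DiagonalSplitting

end Toric

/-! ### The trichotomy -/

theorem mainTheorem6 (k : Type u) [Field k] (N : Type u) [AddCommGroup N] [Module.Free ℤ N]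
    [Module.Finite ℤ N] (hdim : Module.finrank ℤ N = 2) (S : Toric.Fan N) (hS : S.IsComplete) :
    Toric.ExactlyOne
      (Toric.IsUnimodular S.rays ∧ ∀ q : ℕ, 2 ≤ q → Toric.IsDiagonallySplit k S q)
      (Toric.IsRegular 2 S.rays ∧ ¬ Toric.IsUnimodular S.rays ∧
        ∀ q : ℕ, 2 ≤ q → (Toric.IsDiagonallySplit k S q ↔ Odd q))
      (¬ Toric.IsRegular 2 S.rays ∧ ∀ q : ℕ, 2 ≤ q → ¬ Toric.IsDiagonallySplit k S q) := by
  have b : Module.Basis (Fin 2) ℤ N := Module.finBasisOfFinrankEq ℤ N hdim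
  have hprim : ∀ v ∈ S.rays, Toric.IsPrimitive v := fun v hv => hv.1
  have hspan := hS.exists_area_ne_zero b
  have hsplit := fun {q : ℕ} (hq : 2 ≤ q) =>
    Toric.isDiagonallySplit_iff k S b (zero_lt_two.trans_le hq)
  have h12 : Toric.IsUnimodular S.rays → Toric.IsRegular 2 S.rays := by
    rw [Toric.isUnimodular_iff b hspan, Toric.isRegular_two_iff b hprim hspan]
    exact fun h v hv w hw => (h v hv w hw).trans one_le_two
  refine ⟨?_, fun h => h.2.2.1 h.1.1, fun h => h.2.1 (h12 h.1.1), fun h => h.2.1 h.1.1⟩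
  by_cases hr : Toric.IsRegular 2 S.rays
  · by_cases hu : Toric.IsUnimodular S.rays
    · refine Or.inl ⟨hu, fun q hq => (hsplit hq).2 ?_⟩
      obtain ⟨v, hv, w, hw, hvw⟩ := hspan
      exact Toric.hasSmallResidues_of_abs_le_one b
        ((Toric.isUnimodular_iff b ⟨v, hv, w, hw, hvw⟩).1 hu) hv hw hvw (zero_lt_two.trans_le hq)
    · refine Or.inr (Or.inl ⟨hr, hu, fun q hq => ?_⟩)
      rw [Toric.isUnimodular_iff b hspan] at hu
      rw [Toric.isRegular_two_iff b hprim hspan] at hr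
      push Not at hu
      obtain ⟨v, hv, w, hw, hvw⟩ := hu
      have h2 : |Toric.area b v w| = 2 := le_antisymm (hr v hv w hw) hvw
      rw [hsplit hq]
      refine ⟨fun h => ?_, Toric.hasSmallResidues_of_abs_le_two b hprim hr hv hw h2⟩
      by_contra hodd
      rw [Nat.not_odd_iff_even] at hodd
      refine Toric.not_hasSmallResidues b hv hw (hprim v hv) hq ?_ h
      obtain ⟨c, rfl⟩ := hodd
      rw [h2]
      omega
  · refine Or.inr (Or.inr ⟨hr, fun q hq => ?_⟩)
    rw [Toric.isRegular_two_iff b hprim hspan] at hr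
    push Not at hr
    obtain ⟨v, hv, w, hw, hvw⟩ := hr
    rw [hsplit hq]
    refine Toric.not_hasSmallResidues b hv hw (hprim v hv) hq ?_
    -- For `q ≥ 2` one has `3 * (q / 2) ≥ q`, with equality at `q = 3`; so determinant `3` already
    -- obstructs both parities.
    have h3 : (3 : ℤ) * ((q / 2 : ℕ) : ℤ) ≤ |Toric.area b v w| * ((q / 2 : ℕ) : ℤ) :=
      mul_le_mul_of_nonneg_right hvw (by positivity)
    omega
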